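/- Let $U\subset\mathbb{C}$ and $\Omega\subset\mathbb{C}^n$ be bounded domains (non-empty, open, connected), and let $\varphi$ be a real-valued function that is smooth on $\overline{U\times\Omega}$. Define $\Phi:U\to\mathbb{R}$ by $$e^{-\Phi(\tau)}=\int_{\Omega}e^{-\varphi(\tau,z)}\,dV(z),$$ where $dV$ is Lebesgue measure. Let $g:U\to[0,\infty)$ be any non-negative function and put $\omega=\sqrt{-1}\,d\tau\wedge d\bar\tau$. For $a\in U$ write $\Delta(a;r)=\{\tau\in\mathbb{C}: |\tau-a|<r\}$ and $\delta(a)=\sup\{r>0:\Delta(a;r)\subset U\}$. For $0<r<\delta(a)$ let $$K_{\Delta(a;r),\Phi}(a)=\sup\Big\{|f(a)|^2e^{-\Phi(a)} : f \text{ holomorphic on } \Delta(a;r),\ \int_{\Delta(a;r)}|f|^2e^{-\Phi}\le 1\Big\}$$ be the weighted Bergman kernel on the diagonal, and define the $L^2$-extension index by $$L_\Phi(a,r)=\frac{1}{\pi r^2K_{\Delta(a;r),\Phi}(a)}=\inf\left\{\frac{\int_{\Delta(a;r)}|f|^2e^{-\Phi}}{\pi r^2e^{-\Phi(a)}} : f\text{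 holomorphic on }\Delta(a;r),\ \int_{\Delta(a;r)}|f|^2e^{-\Phi}<\infty,\ f(a)=1\right\}.$$ Then the following are equivalent: 1. $\sqrt{-1}\,\partial\bar\partial\Phi\ge g\,\omega$ on $U$, i.e. $\dfrac{\partial^2\Phi}{\partial\tau\,\partial\bar\tau}(a)\ge g(a)$ for every $a\in U$. 2. For every $a\in U$ and every $\varepsilon>0$ there exists $r_\varepsilon\in(0,\delta(a))$ such that $$L_\Phi(a,r)\le e^{-\max\left\{\frac{g(a)-\varepsilon}{2},\,0\right\}r^2}\qquad\text{for all } r\in(0,r_\varepsilon).$$ -/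

import Mathlib

open scoped ENNReal

/-- `∂f/∂z = (f_x - i f_y) / 2`. -/
noncomputable def wirtingerZ (f : ℂ → ℂ) (a : ℂ) : ℂ :=
  (fderiv ℝ f a 1 - Complex.I * fderiv ℝ f a Complex.I) / 2

/-- `∂f/∂z̄ = (f_x + i f_y) / 2`. -/
noncomputable def wirtingerZBar (f : ℂ → ℂ) (a : ℂ) : ℂ :=
  (fderiv ℝ f a 1 + Complex.I * fderiv ℝ f a Complex.I) / 2

/-- The coefficient `∂²ψ/∂z∂z̄` of the real `(1,1)`-form
`i∂∂̄ψ = (∂²ψ/∂z∂z̄) · i dz ∧ dz̄` of a smooth real function `ψ` at `a`. -/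
noncomputable def ddbarCoeff (ψ : ℂ → ℝ) (a : ℂ) : ℝ :=
  (wirtingerZ (wirtingerZBar fun z => (ψ z : ℂ)) a).re

/-- `i∂∂̄ψ ≥ g ω` on `U`, where `ω = i dz ∧ dz̄`: in complex dimension one, an inequality between
real `(1,1)`-forms is the pointwise inequality between their coefficients with respect to `ω`. -/
def CurvatureGE (U : Set ℂ) (ψ g : ℂ → ℝ) : Prop :=
  ∀ a ∈ U, g a ≤ ddbarCoeff ψ a

/-- `∫_D |f|² e^{-ψ}` as an extended nonnegative number. -/
noncomputable def weightedNormSq (D : Set ℂ) (ψ : ℂ → ℝ) (f : ℂ → ℂ) : ℝ≥0∞ :=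
  ∫⁻ z in D, ENNReal.ofReal (‖f z‖ ^ 2 * Real.exp (-ψ z))

/-- `A²(D, ψ)`: holomorphic functions on the open set `D` with `∫_D |f|² e^{-ψ} < ∞`
(values off `D` are irrelevant). -/
def weightedBergmanSpace (D : Set ℂ) (ψ : ℂ → ℝ) : Set (ℂ → ℂ) :=
  {f | DifferentiableOn ℂ f D ∧ weightedNormSq D ψ f < ∞}

/-- The weighted Bergman kernel on the diagonal,
`K_{D,ψ}(a) = sup { |f(a)|² e^{-ψ(a)} : f ∈ A²(D,ψ), ∫_D |f|² e^{-ψ} ≤ 1 }`.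
The value at `a` is measured in the metric `e^{-ψ}`, so the factor `e^{-ψ(a)}` is included. -/
noncomputable def weightedBergmanKernel (D : Set ℂ) (ψ : ℂ → ℝ) (a : ℂ) : ℝ≥0∞ :=
  ⨆ f ∈ {f | f ∈ weightedBergmanSpace D ψ ∧ weightedNormSq D ψ f ≤ 1},
    ENNReal.ofReal (‖f a‖ ^ 2 * Real.exp (-ψ a))

/-- The `L²`-extension index `L_ψ(a, r) = 1 / (π r² K_{Δ(a;r),ψ}(a))`. -/
noncomputable def l2ExtensionIndex (ψ : ℂ → ℝ) (a : ℂ) (r : ℝ) : ℝ≥0∞ :=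
  (ENNReal.ofReal (Real.pi * r ^ 2) * weightedBergmanKernel (Metric.ball a r) ψ a)⁻¹

lemma weightedNormSq_smul (D : Set ℂ) (ψ : ℂ → ℝ) (f : ℂ → ℂ) (c : ℂ) :
    weightedNormSq D ψ (fun z => c * f z) = ENNReal.ofReal (‖c‖ ^ 2) * weightedNormSq D ψ f := by
  unfold weightedNormSq
  rw [← MeasureTheory.lintegral_const_mul' _ _ ENNReal.ofReal_ne_top]
  congr 1
  ext z
  rw [← ENNReal.ofReal_mul (by positivity), norm_mul]
  congr 1
  ring

/-- The index is the best constant in the `L²`-extension problem from the point `a`: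
`L_ψ(a, r) = inf { ∫_{Δ(a;r)} |f|² e^{-ψ} / (π r² e^{-ψ(a)}) : f ∈ A²(Δ(a;r),ψ), f(a) = 1 }`. -/
lemma l2ExtensionIndex_eq_iInf (ψ : ℂ → ℝ) (a : ℂ) {r : ℝ} (hr : 0 < r) :
    l2ExtensionIndex ψ a r =
      ⨅ f ∈ {f | f ∈ weightedBergmanSpace (Metric.ball a r) ψ ∧ f a = 1},
        weightedNormSq (Metric.ball a r) ψ f /
          ENNReal.ofReal (Real.pi * r ^ 2 * Real.exp (-ψ a)) := by
  have hA : (0 : ℝ) < Real.pi * r ^ 2 := by positivity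
  have hE : (0 : ℝ) < Real.exp (-ψ a) := Real.exp_pos _
  have hA0 : ENNReal.ofReal (Real.pi * r ^ 2) ≠ 0 := by simpa using hA
  have hE0 : ENNReal.ofReal (Real.exp (-ψ a)) ≠ 0 := by simpa using hE
  have hAt : ENNReal.ofReal (Real.pi * r ^ 2) ≠ ∞ := ENNReal.ofReal_ne_top
  have hEt : ENNReal.ofReal (Real.exp (-ψ a)) ≠ ∞ := ENNReal.ofReal_ne_top
  rw [l2ExtensionIndex, ENNReal.mul_inv (Or.inl hA0) (Or.inl hAt), weightedBergmanKernel]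
  simp only [ENNReal.inv_iSup]
  rw [ENNReal.ofReal_mul hA.le]
  apply le_antisymm
  · refine le_iInf₂ fun f hf => ?_
    obtain ⟨⟨hd, hfin⟩, hfa⟩ := hf
    rw [ENNReal.div_eq_inv_mul, ENNReal.mul_inv (Or.inl hA0) (Or.inl hAt), mul_assoc]
    gcongr
    have key : ∀ t : ℝ, 0 < t → weightedNormSq (Metric.ball a r) ψ f ≤ ENNReal.ofReal t →
        (⨅ f ∈ {f | f ∈ weightedBergmanSpace (Metric.ball a r) ψ ∧
            weightedNormSq (Metric.ball a r) ψ f ≤ 1},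
          (ENNReal.ofReal (‖f a‖ ^ 2 * Real.exp (-ψ a)))⁻¹)
          ≤ (ENNReal.ofReal (Real.exp (-ψ a)))⁻¹ * ENNReal.ofReal t := by
      intro t ht hft
      have hc : ‖(((Real.sqrt t)⁻¹ : ℝ) : ℂ)‖ ^ 2 = t⁻¹ := by
        rw [Complex.norm_real, Real.norm_eq_abs, sq_abs, inv_pow, Real.sq_sqrt ht.le]
      have hN : weightedNormSq (Metric.ball a r) ψ
          (fun z => (((Real.sqrt t)⁻¹ : ℝ) : ℂ) * f z) ≤ 1 := by
        rw [weightedNormSq_smul, hc]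
        calc _ ≤ ENNReal.ofReal t⁻¹ * ENNReal.ofReal t := by gcongr
          _ = 1 := by rw [← ENNReal.ofReal_mul (by positivity), inv_mul_cancel₀ ht.ne']; simp
      refine (iInf₂_le (fun z => (((Real.sqrt t)⁻¹ : ℝ) : ℂ) * f z)
        ⟨⟨hd.const_mul _, hN.trans_lt ENNReal.one_lt_top⟩, hN⟩).trans (le_of_eq ?_)
      beta_reduce
      rw [hfa, mul_one, hc]
      rw [← ENNReal.ofReal_inv_of_pos (by positivity), ← ENNReal.ofReal_inv_of_pos hE,
        ← ENNReal.ofReal_mul (by positivity)]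
      congr 1
      field_simp
    refine le_of_forall_gt_imp_ge_of_dense fun b hb => ?_
    have hb' : weightedNormSq (Metric.ball a r) ψ f < b * ENNReal.ofReal (Real.exp (-ψ a)) := by
      rwa [← ENNReal.div_eq_inv_mul, ENNReal.div_lt_iff (Or.inl hE0) (Or.inl hEt)] at hb
    by_cases hbt : b = ∞
    · simp [hbt]
    have hbet : b * ENNReal.ofReal (Real.exp (-ψ a)) ≠ ∞ := ENNReal.mul_ne_top hbt hEt
    have h := key (b * ENNReal.ofReal (Real.exp (-ψ a))).toReal
      (ENNReal.toReal_pos (ne_bot_of_gt hb') hbet) (by rw [ENNReal.ofReal_toReal hbet]; exact hb'.le)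
    rw [ENNReal.ofReal_toReal hbet, mul_comm b, ← mul_assoc, ENNReal.inv_mul_cancel hE0 hEt,
      one_mul] at h
    exact h
  · rw [ENNReal.mul_iInf' (fun h => absurd h (ENNReal.inv_ne_top.2 hA0)) (by simp)]
    refine le_iInf fun f => ?_
    rw [ENNReal.mul_iInf' (fun h => absurd h (ENNReal.inv_ne_top.2 hA0))
      (fun h => absurd h (ENNReal.inv_ne_zero.2 hAt))]
    refine le_iInf fun hf => ?_
    obtain ⟨⟨hd, hfin⟩, hN⟩ := hf
    by_cases hfa : f a = 0
    · simp [hfa, ENNReal.mul_top, hAt]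
    have hfa' : (0 : ℝ) < ‖f a‖ := norm_pos_iff.2 hfa
    have hN' : weightedNormSq (Metric.ball a r) ψ (fun z => (f a)⁻¹ * f z)
        ≤ ENNReal.ofReal (‖(f a)⁻¹‖ ^ 2) := by
      rw [weightedNormSq_smul]
      exact mul_le_of_le_one_right' hN
    refine (iInf₂_le (fun z => (f a)⁻¹ * f z)
      ⟨⟨hd.const_mul _, hN'.trans_lt ENNReal.ofReal_lt_top⟩, inv_mul_cancel₀ hfa⟩).trans ?_
    rw [ENNReal.div_eq_inv_mul, ENNReal.mul_inv (Or.inl hA0) (Or.inl hAt), mul_assoc]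
    gcongr
    refine (mul_le_mul_right hN' _).trans (le_of_eq ?_)
    rw [← ENNReal.ofReal_inv_of_pos hE, ← ENNReal.ofReal_inv_of_pos (by positivity),
        ← ENNReal.ofReal_mul (by positivity), norm_inv]
    congr 1
    field_simp

/-- `δ(a) = sup { r > 0 : Δ(a;r) ⊆ U }` for a point `a` of a bounded open set `U`. -/
noncomputable def innerRadius (U : Set ℂ) (a : ℂ) : ℝ :=
  sSup {r : ℝ | 0 < r ∧ Metric.ball a r ⊆ U}

/-- The function `Φ` with `e^{-Φ(τ)} = ∫_{z ∈ Ω} e^{-φ(τ,z)}` (Lebesgue measure on `ℂⁿ`). -/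
noncomputable def fiberPotential {n : ℕ} (Ω : Set (Fin n → ℂ)) (φ : ℂ × (Fin n → ℂ) → ℝ)
    (τ : ℂ) : ℝ :=
  -Real.log (∫ z in Ω, Real.exp (-φ (τ, z)))

/-- The logarithm defining `Φ` is not a junk value. -/
lemma exp_neg_fiberPotential {n : ℕ} {U : Set ℂ} {Ω : Set (Fin n → ℂ)}
    {φ : ℂ × (Fin n → ℂ) → ℝ} (hΩo : IsOpen Ω) (hΩn : Ω.Nonempty) (hΩb : Bornology.IsBounded Ω)
    (hφ : ContinuousOn φ (closure (U ×ˢ Ω))) {τ : ℂ} (hτ : τ ∈ U) :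
    MeasureTheory.IntegrableOn (fun z => Real.exp (-φ (τ, z))) Ω ∧
      Real.exp (-fiberPotential Ω φ τ) = ∫ z in Ω, Real.exp (-φ (τ, z)) := by
  have hc : ContinuousOn (fun z => Real.exp (-φ (τ, z))) (closure Ω) := by
    refine Real.continuous_exp.comp_continuousOn (ContinuousOn.neg (hφ.comp (by fun_prop) ?_))
    intro z hz
    rw [closure_prod_eq]
    exact ⟨subset_closure hτ, hz⟩
  have hi : MeasureTheory.IntegrableOn (fun z => Real.exp (-φ (τ, z))) Ω :=
    (hc.integrableOn_compact hΩb.isCompact_closure).mono_set subset_closure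
  refine ⟨hi, ?_⟩
  rw [fiberPotential, neg_neg, Real.exp_log]
  have hμ : MeasureTheory.volume Ω ≠ 0 := (hΩo.measure_pos _ hΩn).ne'
  have : NeZero (MeasureTheory.volume.restrict Ω) :=
    ⟨by simpa [MeasureTheory.Measure.restrict_eq_zero] using hμ⟩
  exact MeasureTheory.integral_exp_pos hi

/-!
The index `L_Φ(a, r)` is governed by the second-order behaviour of `Φ` at `a`, except in one
degenerate case, where a sharp `L²`-extension theorem is needed.

The function `Φ` is `C²` on `U`: it is minus the logarithm of the integral over the bounded fibre
`Ω` of a function smooth up to the boundary, and one differentiates under the integral sign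
(`contDiffAt_fiberPotential`). Write `c` for `∂²Φ/∂z∂z̄` at `a`. Taylor's formula reads
`Φ(a + h) = Φ(a) + Re P(h) + c |h|² + o(|h|²)` with `P` a holomorphic quadratic polynomial.

* For `f(a) = 1`, apply the mean value property to the holomorphic function `G = f e^{-P/2}`, using
  `|G|² ≥ 2 Re G - 1`: this bounds `∫ |f|² e^{-Φ}` below and gives `L_Φ(a, r) ≥ 1 - b r² / 2` for
  small `r`, for each `b > c` (`exists_le_l2ExtensionIndex`). If the upper bound `e^{-m r²}` also
  holds for small `r`, then `m ≤ b / 2`, and the curvature inequality follows.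
* Conversely `f = e^{P/2}` is a competitor, and shows `L_Φ(a, r) ≤ e^{-m r²}` for small `r` whenever
  `0 ≤ 2 m < c` (`exists_l2ExtensionIndex_le`). This covers the points with `g(a) > ε`.
* If `g(a) ≤ ε`, what is needed is `L_Φ(a, r) ≤ 1`, where `c` may vanish and the expansion says
  nothing. Here the curvature hypothesis is used on a whole disc: `Φ` is subharmonic there since
  `g ≥ 0`, and `L_Φ(a, r) ≤ 1` is the Ohsawa–Takegoshi theorem with its optimal constant, for a disc
  and its centre (`exists_sharp_extension`).

The sharp extension theorem is proved by duality. Let `χ` be a cut-off equal to `1` near `a`, so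
that `χ_z̄ = (z - a) k`. The crucial inequality (`sharp_basic_estimate`) is
`π |A(a)|² e^{Φ(a)} ≤ R² ∫ |A_z̄ / (z - a)|² e^Φ` for test functions `A` on `Δ(a; R)`; applied to
`A = χ - (z - a) B` it says that `k` keeps a definite distance, in `L²(e^Φ)`, from the functions
`B_z̄`. The component of `k` orthogonal to these functions is, up to the weight and a conjugation, a
weak solution of `∂̄F = 0`, hence holomorphic by Weyl's lemma (`exists_holomorphic_ae_eq`), and a
multiple of it is the required extension. The inequality itself comes from a twisted
Bochner–Kodaira identity (`wirtinger_twistField`) on the disc with the singularity at `a`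
regularised: with `y = (|z - a|² + η) / R²`, the density `e^Φ / (1 - y)` and the twist `w(y)`, all
error terms are absorbed, with the right constant, when `w - (1 - y) w' = (1 - y) / y`, whose
solution vanishing at `y = 1` is `w = (-log y + y - 1) / (1 - y)`. As `η → 0` the remaining
curvature term `η / (|z - a|² + η)²` converges to `π` times the Dirac mass at `a`, which is where
the optimal constant comes from.
-/

open scoped ENNReal
open MeasureTheory Filter Topology ComplexConjugate

/-! ### Wirtinger calculus -/

lemma wirtingerZBar_congr {f g : ℂ → ℂ} {a : ℂ} (h : f =ᶠ[𝓝 a] g) :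
    wirtingerZBar f a = wirtingerZBar g a := by
  simp only [wirtingerZBar, h.fderiv_eq]

lemma wirtingerZ_add {f g : ℂ → ℂ} {a : ℂ} (hf : DifferentiableAt ℝ f a)
    (hg : DifferentiableAt ℝ g a) :
    wirtingerZ (fun z => f z + g z) a = wirtingerZ f a + wirtingerZ g a := by
  simp only [wirtingerZ, fderiv_fun_add hf hg, add_apply]; ring

lemma wirtingerZBar_add {f g : ℂ → ℂ} {a : ℂ} (hf : DifferentiableAt ℝ f a)
    (hg : DifferentiableAt ℝ g a) :
    wirtingerZBar (fun z => f z + g z) a = wirtingerZBar f a + wirtingerZBar g a := by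
  simp only [wirtingerZBar, fderiv_fun_add hf hg, add_apply]; ring

lemma wirtingerZ_mul {f g : ℂ → ℂ} {a : ℂ} (hf : DifferentiableAt ℝ f a)
    (hg : DifferentiableAt ℝ g a) :
    wirtingerZ (fun z => f z * g z) a = wirtingerZ f a * g a + f a * wirtingerZ g a := by
  simp only [wirtingerZ, fderiv_fun_mul hf hg, add_apply,
    smul_apply, smul_eq_mul]; ring

lemma wirtingerZBar_mul {f g : ℂ → ℂ} {a : ℂ} (hf : DifferentiableAt ℝ f a)
    (hg : DifferentiableAt ℝ g a) :
    wirtingerZBar (fun z => f z * g z) a = wirtingerZBar f a * g a + f a * wirtingerZBar g a := by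
  simp only [wirtingerZBar, fderiv_fun_mul hf hg, add_apply,
    smul_apply, smul_eq_mul]; ring

lemma fderiv_conj_comp {f : ℂ → ℂ} {a : ℂ} (hf : DifferentiableAt ℝ f a) (v : ℂ) :
    fderiv ℝ (fun z => conj (f z)) a v = conj (fderiv ℝ f a v) := by
  have := (Complex.conjCLE.toContinuousLinearMap.hasFDerivAt (x := f a)).comp a hf.hasFDerivAt
  have h2 : HasFDerivAt (fun z => conj (f z))
    (Complex.conjCLE.toContinuousLinearMap.comp (fderiv ℝ f a)) a := this
  rw [h2.fderiv]; simp

lemma wirtingerZ_conj {f : ℂ → ℂ} {a : ℂ} (hf : DifferentiableAt ℝ f a) :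
    wirtingerZ (fun z => conj (f z)) a = conj (wirtingerZBar f a) := by
  simp only [wirtingerZ, wirtingerZBar, fderiv_conj_comp hf]
  simp [map_div₀, map_ofNat]; ring

lemma wirtingerZBar_conj {f : ℂ → ℂ} {a : ℂ} (hf : DifferentiableAt ℝ f a) :
    wirtingerZBar (fun z => conj (f z)) a = conj (wirtingerZ f a) := by
  simp only [wirtingerZ, wirtingerZBar, fderiv_conj_comp hf]
  simp [map_div₀, map_ofNat]

lemma wirtingerZ_ofReal {u : ℂ → ℝ} {a : ℂ} (hu : DifferentiableAt ℝ (fun z => (u z : ℂ)) a) :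
    wirtingerZ (fun z => (u z : ℂ)) a = conj (wirtingerZBar (fun z => (u z : ℂ)) a) := by
  rw [← wirtingerZ_conj hu]; simp

lemma fderiv_ofReal_comp_comp {ω : ℝ → ℝ} {u : ℂ → ℝ} {a : ℂ} {ω' : ℝ}
    (hω : HasDerivAt ω ω' (u a)) (hu : DifferentiableAt ℝ u a) (v : ℂ) :
    fderiv ℝ (fun z => (ω (u z) : ℂ)) a v = ω' * fderiv ℝ (fun z => (u z : ℂ)) a v := by
  have h1 : HasFDerivAt (fun z => (ω (u z) : ℂ))
      (Complex.ofRealCLM.comp (ω' • fderiv ℝ u a)) a :=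
    (Complex.ofRealCLM.hasFDerivAt).comp a (hω.comp_hasFDerivAt a hu.hasFDerivAt)
  have h2 : HasFDerivAt (fun z => (u z : ℂ)) (Complex.ofRealCLM.comp (fderiv ℝ u a)) a :=
    (Complex.ofRealCLM.hasFDerivAt).comp a hu.hasFDerivAt
  rw [h1.fderiv, h2.fderiv]; simp

lemma wirtingerZ_ofReal_comp {ω : ℝ → ℝ} {u : ℂ → ℝ} {a : ℂ} {ω' : ℝ}
    (hω : HasDerivAt ω ω' (u a)) (hu : DifferentiableAt ℝ u a) :
    wirtingerZ (fun z => (ω (u z) : ℂ)) a = ω' * wirtingerZ (fun z => (u z : ℂ)) a := by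
  simp only [wirtingerZ, fderiv_ofReal_comp_comp hω hu]; ring

lemma wirtingerZBar_ofReal_comp {ω : ℝ → ℝ} {u : ℂ → ℝ} {a : ℂ} {ω' : ℝ}
    (hω : HasDerivAt ω ω' (u a)) (hu : DifferentiableAt ℝ u a) :
    wirtingerZBar (fun z => (ω (u z) : ℂ)) a = ω' * wirtingerZBar (fun z => (u z : ℂ)) a := by
  simp only [wirtingerZBar, fderiv_ofReal_comp_comp hω hu]; ring

lemma wirtingerZBar_eq_zero {f : ℂ → ℂ} {a : ℂ} (hf : DifferentiableAt ℂ f a) :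
    wirtingerZBar f a = 0 := by
  have h := hf.fderiv_restrictScalars ℝ
  simp only [wirtingerZBar, h, ContinuousLinearMap.coe_restrictScalars']
  have : fderiv ℂ f a Complex.I = Complex.I * fderiv ℂ f a 1 := by
    rw [← smul_eq_mul, ← map_smul]; simp
  rw [this, ← mul_assoc, Complex.I_mul_I]; ring

lemma wirtingerZ_eq_deriv {f : ℂ → ℂ} {a : ℂ} (hf : DifferentiableAt ℂ f a) :
    wirtingerZ f a = deriv f a := by
  have h := hf.fderiv_restrictScalars ℝ
  simp only [wirtingerZ, h, ContinuousLinearMap.coe_restrictScalars']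
  have : fderiv ℂ f a Complex.I = Complex.I * fderiv ℂ f a 1 := by
    rw [← smul_eq_mul, ← map_smul]; simp
  rw [this, ← mul_assoc, Complex.I_mul_I, fderiv_apply_one_eq_deriv]; ring

lemma contDiffAt_fderiv_apply {f : ℂ → ℂ} {a : ℂ} {m n : ℕ∞} (hf : ContDiffAt ℝ n f a)
    (hmn : m + 1 ≤ n) (v : ℂ) : ContDiffAt ℝ m (fun z => fderiv ℝ f z v) a :=
  (hf.fderiv_right (by exact_mod_cast hmn)).clm_apply contDiffAt_const

lemma ContDiffAt.wirtingerZ {f : ℂ → ℂ} {a : ℂ} {m n : ℕ∞} (hf : ContDiffAt ℝ n f a)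
    (hmn : m + 1 ≤ n) : ContDiffAt ℝ m (wirtingerZ f) a :=
  ((contDiffAt_fderiv_apply hf hmn 1).sub
    (contDiffAt_const.mul (contDiffAt_fderiv_apply hf hmn Complex.I))).div_const 2

lemma ContDiffAt.wirtingerZBar {f : ℂ → ℂ} {a : ℂ} {m n : ℕ∞} (hf : ContDiffAt ℝ n f a)
    (hmn : m + 1 ≤ n) : ContDiffAt ℝ m (wirtingerZBar f) a :=
  ((contDiffAt_fderiv_apply hf hmn 1).add
    (contDiffAt_const.mul (contDiffAt_fderiv_apply hf hmn Complex.I))).div_const 2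

lemma fderiv_fderiv_apply {f : ℂ → ℂ} {a : ℂ} (hf : ContDiffAt ℝ 2 f a) (v w : ℂ) :
    fderiv ℝ (fun z => fderiv ℝ f z v) a w = fderiv ℝ (fderiv ℝ f) a w v := by
  have h : DifferentiableAt ℝ (fderiv ℝ f) a :=
    (hf.fderiv_right (m := 1) (by norm_num)).differentiableAt (by norm_num)
  rw [fderiv_clm_apply h (differentiableAt_const v)]; simp

lemma wirtingerZ_wirtingerZBar {f : ℂ → ℂ} {a : ℂ} (hf : ContDiffAt ℝ 2 f a) :
    wirtingerZ (wirtingerZBar f) a =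
      (fderiv ℝ (fderiv ℝ f) a 1 1 + fderiv ℝ (fderiv ℝ f) a Complex.I Complex.I) / 4 := by
  have hd : ∀ v, DifferentiableAt ℝ (fun z => fderiv ℝ f z v) a := fun v =>
    (contDiffAt_fderiv_apply (m := 1) (n := 2) hf (by norm_num) v).differentiableAt (by norm_num)
  have hs : fderiv ℝ (fderiv ℝ f) a 1 Complex.I = fderiv ℝ (fderiv ℝ f) a Complex.I 1 :=
    (hf.isSymmSndFDerivAt (by simp)).eq 1 Complex.I
  have key : ∀ w, fderiv ℝ (wirtingerZBar f) a w =
      (fderiv ℝ (fderiv ℝ f) a w 1 + Complex.I * fderiv ℝ (fderiv ℝ f) a w Complex.I) / 2 := by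
    intro w
    have h : HasFDerivAt (wirtingerZBar f) ((1 / 2 : ℂ) •
        (fderiv ℝ (fun z => fderiv ℝ f z 1) a +
          Complex.I • fderiv ℝ (fun z => fderiv ℝ f z Complex.I) a)) a := by
      have := (((hd 1).hasFDerivAt).add (((hd Complex.I).hasFDerivAt).const_mul
        Complex.I)).const_mul (1 / 2 : ℂ)
      refine this.congr_of_eventuallyEq (Eventually.of_forall fun z => ?_)
      simp only [wirtingerZBar, Pi.add_apply]; ring
    rw [h.fderiv]
    simp [fderiv_fderiv_apply hf]; ring
  simp only [wirtingerZ, key, hs]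
  linear_combination (-1/4) * fderiv ℝ (fderiv ℝ f) a Complex.I Complex.I * Complex.I_sq

lemma wirtingerZBar_wirtingerZ {f : ℂ → ℂ} {a : ℂ} (hf : ContDiffAt ℝ 2 f a) :
    wirtingerZBar (wirtingerZ f) a = wirtingerZ (wirtingerZBar f) a := by
  have hev : ∀ᶠ z in 𝓝 a, DifferentiableAt ℝ f z :=
    (hf.eventually (by simp)).mono fun z hz => hz.differentiableAt (by norm_num)
  have hd : DifferentiableAt ℝ f a := hf.differentiableAt (by norm_num)
  have hc : ContDiffAt ℝ 2 (fun z => conj (f z)) a :=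
    Complex.conjCLE.contDiff.contDiffAt.comp a hf
  -- conjugating `f` exchanges the two operators
  have h1 : wirtingerZBar (wirtingerZ f) a
      = conj (wirtingerZ (wirtingerZBar fun z => conj (f z)) a) := by
    have e : wirtingerZ f =ᶠ[𝓝 a] fun z => conj (wirtingerZBar (fun z => conj (f z)) z) :=
      hev.mono fun z hz => by simp [wirtingerZBar_conj hz]
    rw [wirtingerZBar_congr e, wirtingerZBar_conj]
    exact (hc.wirtingerZBar (m := 1) (by norm_num)).differentiableAt (by norm_num)
  have h2 : ∀ v w, fderiv ℝ (fderiv ℝ fun z => conj (f z)) a v w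
      = conj (fderiv ℝ (fderiv ℝ f) a v w) := by
    intro v w
    rw [← fderiv_fderiv_apply hc, ← fderiv_fderiv_apply hf, ← fderiv_conj_comp]
    · exact congrArg (fun L : ℂ →L[ℝ] ℂ => L v)
        (EventuallyEq.fderiv_eq (hev.mono fun z hz => fderiv_conj_comp hz w))
    · exact (contDiffAt_fderiv_apply (m := 1) (n := 2) hf (by norm_num) w).differentiableAt
        (by norm_num)
  rw [h1, wirtingerZ_wirtingerZBar hf, wirtingerZ_wirtingerZBar hc, h2, h2]
  simp [map_div₀, map_ofNat]

lemma integral_fderiv_apply_eq_zero {G : ℂ → ℂ} (hG : ContDiff ℝ 1 G) (hc : HasCompactSupport G)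
    (v : ℂ) : ∫ z, fderiv ℝ G z v = 0 := by
  have hi : Integrable (fun z => fderiv ℝ G z v) :=
    ((hG.continuous_fderiv (by norm_num)).clm_apply continuous_const).integrable_of_hasCompactSupport
      (hc.fderiv_apply (𝕜 := ℝ) v)
  have := integral_mul_fderiv_eq_neg_fderiv_mul_of_integrable (μ := volume) (f := fun _ : ℂ => (1:ℂ))
    (g := G) (v := v) (by simp) (by simpa using hi)
    (by simpa using hG.continuous.integrable_of_hasCompactSupport hc) (by simp)
    (fun x _ => hG.differentiable (by norm_num) x)
  simpa using this

lemma integrable_fderiv_apply {G : ℂ → ℂ} (hG : ContDiff ℝ 1 G) (hc : HasCompactSupport G)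
    (v : ℂ) : Integrable (fun z => fderiv ℝ G z v) :=
  ((hG.continuous_fderiv (by norm_num)).clm_apply continuous_const).integrable_of_hasCompactSupport
      (hc.fderiv_apply (𝕜 := ℝ) v)

lemma integral_wirtingerZ_eq_zero {G : ℂ → ℂ} (hG : ContDiff ℝ 1 G) (hc : HasCompactSupport G) :
    ∫ z, wirtingerZ G z = 0 := by
  simp only [wirtingerZ]
  rw [integral_div, integral_sub (integrable_fderiv_apply hG hc 1)
    ((integrable_fderiv_apply hG hc Complex.I).const_mul _), integral_const_mul,
    integral_fderiv_apply_eq_zero hG hc, integral_fderiv_apply_eq_zero hG hc]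
  simp

lemma integral_wirtingerZBar_eq_zero {G : ℂ → ℂ} (hG : ContDiff ℝ 1 G)
    (hc : HasCompactSupport G) : ∫ z, wirtingerZBar G z = 0 := by
  simp only [wirtingerZBar]
  rw [integral_div, integral_add (integrable_fderiv_apply hG hc 1)
    ((integrable_fderiv_apply hG hc Complex.I).const_mul _), integral_const_mul,
    integral_fderiv_apply_eq_zero hG hc, integral_fderiv_apply_eq_zero hG hc]
  simp

lemma HasCompactSupport.wirtingerZBar {G : ℂ → ℂ} (hc : HasCompactSupport G) :
    HasCompactSupport (wirtingerZBar G) := by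
  have h : HasCompactSupport (fderiv ℝ G) := hc.fderiv (𝕜 := ℝ)
  exact h.mono fun z hz => by
    contrapose! hz
    simp only [Function.mem_support, not_not] at hz ⊢
    simp [_root_.wirtingerZBar, hz]

lemma HasCompactSupport.wirtingerZ {G : ℂ → ℂ} (hc : HasCompactSupport G) :
    HasCompactSupport (wirtingerZ G) := by
  have h : HasCompactSupport (fderiv ℝ G) := hc.fderiv (𝕜 := ℝ)
  exact h.mono fun z hz => by
    contrapose! hz
    simp only [Function.mem_support, not_not] at hz ⊢
    simp [_root_.wirtingerZ, hz]

lemma tsupport_wirtingerZBar_subset (G : ℂ → ℂ) : tsupport (wirtingerZBar G) ⊆ tsupport G := by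
  refine closure_minimal (fun z hz => ?_) (isClosed_tsupport G)
  by_contra h
  have := fderiv_of_notMem_tsupport (𝕜 := ℝ) h
  exact hz (by simp [wirtingerZBar, this])

lemma ContDiff.continuous_wirtingerZBar {G : ℂ → ℂ} (hG : ContDiff ℝ 1 G) :
    Continuous (wirtingerZBar G) :=
  continuous_iff_continuousAt.2 fun z =>
    (hG.contDiffAt.wirtingerZBar (m := 0) (n := 1) (by norm_num)).continuousAt

lemma ContDiff.continuous_wirtingerZ {G : ℂ → ℂ} (hG : ContDiff ℝ 1 G) :
    Continuous (wirtingerZ G) :=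
  continuous_iff_continuousAt.2 fun z =>
    (hG.contDiffAt.wirtingerZ (m := 0) (n := 1) (by norm_num)).continuousAt

/-! ### The twisted Bochner–Kodaira identity -/

/-- The twist `w`: the function on `(0, 1)` that solves `w - (1 - t) w' = (1 - t) / t` and tends
to `0` at `1`. It is nonnegative and decreasing. -/
noncomputable def twistWeight (t : ℝ) : ℝ := (-Real.log t + t - 1) / (1 - t)

/-- Minus the derivative of `twistWeight`. -/
noncomputable def twistSlope (t : ℝ) : ℝ := 1 / t - twistWeight t / (1 - t)

lemma hasDerivAt_twistWeight {t : ℝ} (h0 : 0 < t) (h1 : t < 1) :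
    HasDerivAt twistWeight (-twistSlope t) t := by
  have h1' : (1 - t) ≠ 0 := by linarith
  have := (((Real.hasDerivAt_log h0.ne').neg.add (hasDerivAt_id t)).sub_const 1).div
    ((hasDerivAt_id t).const_sub 1) h1'
  refine this.congr_deriv ?_
  simp only [twistSlope, twistWeight, id, Pi.add_apply, Pi.neg_apply]
  field_simp
  ring

lemma hasDerivAt_twistSlope {t : ℝ} (h0 : 0 < t) (h1 : t < 1) :
    HasDerivAt twistSlope (-1 / t ^ 2 + twistSlope t / (1 - t) - twistWeight t / (1 - t) ^ 2)
      t := by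
  have h1' : (1 - t) ≠ 0 := by linarith
  have := ((hasDerivAt_const t (1:ℝ)).div (hasDerivAt_id t) h0.ne').sub
    ((hasDerivAt_twistWeight h0 h1).div ((hasDerivAt_id t).const_sub 1) h1')
  refine this.congr_deriv ?_
  simp only [id]
  field_simp
  ring

lemma twistWeight_nonneg {t : ℝ} (h0 : 0 < t) (h1 : t < 1) : 0 ≤ twistWeight t :=
  div_nonneg (by linarith [Real.log_le_sub_one_of_pos h0]) (by linarith)

lemma twistSlope_nonneg {t : ℝ} (h0 : 0 < t) (h1 : t < 1) : 0 ≤ twistSlope t := by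
  have h1' : 0 < 1 - t := by linarith
  have h := Real.log_le_sub_one_of_pos (inv_pos.2 h0)
  rw [Real.log_inv] at h
  have h2 : t * -Real.log t ≤ t * (t⁻¹ - 1) := mul_le_mul_of_nonneg_left h h0.le
  rw [mul_sub, mul_inv_cancel₀ h0.ne'] at h2
  have : twistSlope t = (1 - t + t * Real.log t) / (t * (1 - t) ^ 2) := by
    simp only [twistSlope, twistWeight]; field_simp; ring
  rw [this]
  exact div_nonneg (by linarith) (by positivity)

lemma twistWeight_add_twistSlope {t : ℝ} (h0 : 0 < t) (h1 : t < 1) :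
    twistWeight t + twistSlope t * (1 - t) = (1 - t) / t := by
  have h1' : (1 - t) ≠ 0 := by linarith
  simp only [twistSlope]; field_simp; ring

lemma contDiffAt_twistWeight {t : ℝ} (h0 : 0 < t) (h1 : t < 1) (n : ℕ∞) :
    ContDiffAt ℝ n twistWeight t :=
  (((Real.contDiffAt_log.2 h0.ne').neg.add contDiffAt_id).sub contDiffAt_const).div
    (contDiffAt_const.sub contDiffAt_id) (by show (1:ℝ) - _ ≠ 0; linarith)

lemma contDiffAt_twistSlope {t : ℝ} (h0 : 0 < t) (h1 : t < 1) (n : ℕ∞) :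
    ContDiffAt ℝ n twistSlope t :=
  (contDiffAt_const.div contDiffAt_id h0.ne').sub ((contDiffAt_twistWeight h0 h1 n).div
    (contDiffAt_const.sub contDiffAt_id) (by show (1:ℝ) - _ ≠ 0; linarith))

/-- The regularised squared distance `(|z - a|² + η) / ρ`. -/
noncomputable def shiftedSq (a : ℂ) (η ρ : ℝ) (z : ℂ) : ℝ := (Complex.normSq (z - a) + η) / ρ

lemma contDiff_normSq_sub (a : ℂ) {n : ℕ∞} : ContDiff ℝ n (fun z => Complex.normSq (z - a)) := by
  have : (fun z : ℂ => Complex.normSq (z - a)) = fun z => ‖z - a‖ ^ 2 := by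
    ext z; rw [Complex.normSq_eq_norm_sq]
  rw [this]
  exact (contDiff_id.sub contDiff_const).norm_sq ℝ

lemma contDiff_shiftedSq (a : ℂ) (η ρ : ℝ) {n : ℕ∞} : ContDiff ℝ n (shiftedSq a η ρ) :=
  ((contDiff_normSq_sub a).add contDiff_const).div_const ρ

lemma differentiableAt_conj_sub (a z : ℂ) : DifferentiableAt ℝ (fun z : ℂ => conj (z - a)) z :=
  Complex.conjCLE.differentiableAt.comp z (differentiableAt_id.sub_const a)

lemma wirtingerZ_sub_const (a z : ℂ) : wirtingerZ (fun z => z - a) z = 1 := by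
  rw [wirtingerZ_eq_deriv (by fun_prop)]; simp

lemma wirtingerZBar_sub_const (a z : ℂ) : wirtingerZBar (fun z => z - a) z = 0 :=
  wirtingerZBar_eq_zero (by fun_prop)

lemma wirtingerZ_shiftedSq (a : ℂ) (η ρ : ℝ) (z : ℂ) :
    wirtingerZ (fun z => (shiftedSq a η ρ z : ℂ)) z = conj (z - a) / ρ := by
  have e : (fun z => (shiftedSq a η ρ z : ℂ)) =
      fun z => ((z - a) * conj (z - a) + η) * (1 / ρ : ℂ) := by
    ext z; simp only [shiftedSq, Complex.mul_conj]; push_cast; ring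
  have hs : DifferentiableAt ℝ (fun z : ℂ => z - a) z := by fun_prop
  have hc := differentiableAt_conj_sub a z
  rw [e, wirtingerZ_mul ((hs.fun_mul hc).fun_add (differentiableAt_const _)) (by fun_prop),
    wirtingerZ_add (hs.fun_mul hc) (by fun_prop), wirtingerZ_mul hs hc, wirtingerZ_conj hs,
    wirtingerZ_sub_const, wirtingerZBar_sub_const]
  simp [wirtingerZ]; ring

lemma wirtingerZBar_shiftedSq (a : ℂ) (η ρ : ℝ) (z : ℂ) :
    wirtingerZBar (fun z => (shiftedSq a η ρ z : ℂ)) z = (z - a) / ρ := by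
  have h : DifferentiableAt ℝ (fun z => (shiftedSq a η ρ z : ℂ)) z :=
    Complex.ofRealCLM.differentiableAt.comp z
      ((contDiff_shiftedSq a η ρ (n := 1)).differentiable (by norm_num) z)
  have := congrArg conj (wirtingerZ_ofReal h)
  rw [wirtingerZ_shiftedSq] at this
  simpa [map_div₀] using this.symm

lemma contDiffAt_ofReal_comp {u : ℂ → ℝ} {z : ℂ} {n : ℕ∞} (h : ContDiffAt ℝ n u z) :
    ContDiffAt ℝ n (fun z => (u z : ℂ)) z :=
  Complex.ofRealCLM.contDiff.contDiffAt.comp z h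

lemma wirtingerZBar_wirtingerZ_ofReal {Φ : ℂ → ℝ} {z : ℂ} (hΦ : ContDiffAt ℝ 2 Φ z) :
    wirtingerZBar (wirtingerZ fun z => (Φ z : ℂ)) z = (ddbarCoeff Φ z : ℂ) := by
  have hc : ContDiffAt ℝ 2 (fun z => (Φ z : ℂ)) z := contDiffAt_ofReal_comp (n := 2) hΦ
  have hev : ∀ᶠ z in 𝓝 z, DifferentiableAt ℝ (fun z => (Φ z : ℂ)) z :=
    (hc.eventually (by simp)).mono fun z hz => hz.differentiableAt (by norm_num)
  have e : wirtingerZ (fun z => (Φ z : ℂ)) =ᶠ[𝓝 z]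
      fun z => conj (wirtingerZBar (fun z => (Φ z : ℂ)) z) :=
    hev.mono fun z hz => wirtingerZ_ofReal hz
  have h1 : wirtingerZBar (wirtingerZ fun z => (Φ z : ℂ)) z
      = conj (wirtingerZ (wirtingerZBar fun z => (Φ z : ℂ)) z) := by
    rw [wirtingerZBar_congr e, wirtingerZBar_conj]
    exact (hc.wirtingerZBar (m := 1) (by norm_num)).differentiableAt (by norm_num)
  have h2 := wirtingerZBar_wirtingerZ hc
  rw [h1] at h2
  rw [h1, h2]
  exact (Complex.conj_eq_iff_re.1 h2).symm

section Twist
variable (a : ℂ) (η ρ : ℝ) (Φ : ℂ → ℝ) (A : ℂ → ℂ)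

/-- The density `e^Φ / (1 - y)` with `y = shiftedSq a η ρ`. -/
noncomputable def twistDensity (z : ℂ) : ℝ := Real.exp (Φ z) * (1 / (1 - shiftedSq a η ρ z))

/-- The field `Ā N ∂(w A)/∂z̄`, where `N` is `twistDensity`, `w` is `twistWeight` at
`y = shiftedSq a η ρ`, and the derivative of the product is written out. -/
noncomputable def twistFieldZ (z : ℂ) : ℂ :=
  (conj (A z) * (twistDensity a η ρ Φ z : ℂ)) *
    ((twistWeight (shiftedSq a η ρ z) : ℂ) * wirtingerZBar A z +
      (-1) * (twistSlope (shiftedSq a η ρ z) : ℂ) * ((z - a) * (1 / ρ : ℂ)) * A z)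

/-- The field `Ā w ∂(N A)/∂z`, where `N` is `twistDensity`, `w` is `twistWeight` at
`y = shiftedSq a η ρ`, and the derivative of the product is written out. -/
noncomputable def twistFieldZBar (z : ℂ) : ℂ :=
  (conj (A z) * (twistDensity a η ρ Φ z : ℂ)) * (twistWeight (shiftedSq a η ρ z) : ℂ) *
    (wirtingerZ A z + A z * (wirtingerZ (fun z => (Φ z : ℂ)) z +
      (1 / ρ : ℂ) * conj (z - a) * ((1 / (1 - shiftedSq a η ρ z) : ℝ) : ℂ)))

variable {a η ρ Φ A} {z : ℂ}

lemma contDiffAt_conj {n : ℕ∞} {f : ℂ → ℂ} (h : ContDiffAt ℝ n f z) :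
    ContDiffAt ℝ n (fun z => conj (f z)) z :=
  Complex.conjCLE.contDiff.contDiffAt.comp z h

lemma hasDerivAt_one_div_one_sub {t : ℝ} (h1 : t < 1) :
    HasDerivAt (fun t : ℝ => 1 / (1 - t)) (1 / (1 - t) ^ 2) t := by
  have := (hasDerivAt_const t (1 : ℝ)).div ((hasDerivAt_id t).const_sub 1)
    (by show (1 : ℝ) - t ≠ 0; linarith)
  exact this.congr_deriv (by simp)

lemma contDiffAt_one_div_one_sub {t : ℝ} (h1 : t < 1) (n : ℕ∞) :
    ContDiffAt ℝ n (fun t : ℝ => 1 / (1 - t)) t :=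
  contDiffAt_const.div (contDiffAt_const.sub contDiffAt_id) (by show (1:ℝ) - _ ≠ 0; linarith)

lemma contDiffAt_twistDensity (h1 : shiftedSq a η ρ z < 1) {n : ℕ∞} (hΦ : ContDiffAt ℝ n Φ z) :
    ContDiffAt ℝ n (twistDensity a η ρ Φ) z :=
  hΦ.exp.mul ((contDiffAt_one_div_one_sub h1 n).comp z (contDiff_shiftedSq a η ρ).contDiffAt)

lemma wirtinger_twistDensity (h1 : shiftedSq a η ρ z < 1) (hΦ : ContDiffAt ℝ 2 Φ z) :
    wirtingerZ (fun z => (twistDensity a η ρ Φ z : ℂ)) z = twistDensity a η ρ Φ z *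
      (wirtingerZ (fun z => (Φ z : ℂ)) z +
        (1 / ρ : ℂ) * conj (z - a) * ((1 / (1 - shiftedSq a η ρ z) : ℝ) : ℂ)) ∧
    wirtingerZBar (fun z => (twistDensity a η ρ Φ z : ℂ)) z = twistDensity a η ρ Φ z *
      (wirtingerZBar (fun z => (Φ z : ℂ)) z +
        (1 / ρ : ℂ) * (z - a) * ((1 / (1 - shiftedSq a η ρ z) : ℝ) : ℂ)) := by
  have hy : DifferentiableAt ℝ (shiftedSq a η ρ) z :=
    (contDiff_shiftedSq a η ρ (n := 1)).differentiable (by norm_num) z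
  have hm : HasDerivAt (fun t : ℝ => 1 / (1 - t)) (1 / (1 - shiftedSq a η ρ z) ^ 2)
      (shiftedSq a η ρ z) := hasDerivAt_one_div_one_sub h1
  have h1' : (1 - shiftedSq a η ρ z : ℂ) ≠ 0 := by norm_cast; linarith
  have hΦd : DifferentiableAt ℝ Φ z := hΦ.differentiableAt (by norm_num)
  have d1 : DifferentiableAt ℝ (fun z => (Real.exp (Φ z) : ℂ)) z :=
    Complex.ofRealCLM.differentiableAt.comp z hΦd.exp
  have d2 : DifferentiableAt ℝ (fun z => ((1 / (1 - shiftedSq a η ρ z) : ℝ) : ℂ)) z :=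
    Complex.ofRealCLM.differentiableAt.comp z (hm.differentiableAt.comp z hy)
  have e : (fun z => (twistDensity a η ρ Φ z : ℂ)) =
      fun z => (Real.exp (Φ z) : ℂ) * ((1 / (1 - shiftedSq a η ρ z) : ℝ) : ℂ) := by
    ext z; simp [twistDensity]
  constructor
  · rw [e, wirtingerZ_mul d1 d2, wirtingerZ_ofReal_comp (Real.hasDerivAt_exp _) hΦd,
      wirtingerZ_ofReal_comp (ω := fun t : ℝ => 1 / (1 - t)) hm hy, wirtingerZ_shiftedSq]
    simp only [twistDensity]; push_cast; field_simp
  · rw [e, wirtingerZBar_mul d1 d2, wirtingerZBar_ofReal_comp (Real.hasDerivAt_exp _) hΦd,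
      wirtingerZBar_ofReal_comp (ω := fun t : ℝ => 1 / (1 - t)) hm hy, wirtingerZBar_shiftedSq]
    simp only [twistDensity]; push_cast; field_simp

lemma contDiffAt_twistField (h0 : 0 < shiftedSq a η ρ z) (h1 : shiftedSq a η ρ z < 1)
    (hΦ : ContDiffAt ℝ 2 Φ z) (hA : ContDiffAt ℝ 2 A z) :
    ContDiffAt ℝ 1 (twistFieldZ a η ρ Φ A) z ∧ ContDiffAt ℝ 1 (twistFieldZBar a η ρ Φ A) z := by
  have hA1 : ContDiffAt ℝ 1 A z := hA.of_le (by norm_num)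
  have hy : ContDiffAt ℝ 1 (shiftedSq a η ρ) z := (contDiff_shiftedSq a η ρ (n := 1)).contDiffAt
  have hw : ContDiffAt ℝ 1 (fun z => (twistWeight (shiftedSq a η ρ z) : ℂ)) z :=
    contDiffAt_ofReal_comp (n := 1) ((contDiffAt_twistWeight h0 h1 1).comp z hy)
  have hk : ContDiffAt ℝ 1 (fun z => (twistSlope (shiftedSq a η ρ z) : ℂ)) z :=
    contDiffAt_ofReal_comp (n := 1) ((contDiffAt_twistSlope h0 h1 1).comp z hy)
  have hm : ContDiffAt ℝ 1 (fun z => ((1 / (1 - shiftedSq a η ρ z) : ℝ) : ℂ)) z :=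
    contDiffAt_ofReal_comp (n := 1) ((contDiffAt_one_div_one_sub h1 1).comp z hy)
  have hN : ContDiffAt ℝ 1 (fun z => (twistDensity a η ρ Φ z : ℂ)) z :=
    contDiffAt_ofReal_comp (n := 1) (contDiffAt_twistDensity h1 (n := 1) (hΦ.of_le (by norm_num)))
  have hs : ContDiffAt ℝ 1 (fun z : ℂ => z - a) z := contDiffAt_id.sub contDiffAt_const
  have hAc := contDiffAt_conj (n := 1) hA1
  have hΦz : ContDiffAt ℝ 1 (wirtingerZ fun z => (Φ z : ℂ)) z :=
    (contDiffAt_ofReal_comp (n := 2) hΦ).wirtingerZ (m := 1) (n := 2) (by norm_num)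
  have hAz : ContDiffAt ℝ 1 (wirtingerZ A) z := hA.wirtingerZ (m := 1) (n := 2) (by norm_num)
  have hAzb : ContDiffAt ℝ 1 (wirtingerZBar A) z :=
    hA.wirtingerZBar (m := 1) (n := 2) (by norm_num)
  exact ⟨(hAc.mul hN).mul ((hw.mul hAzb).add
      (((contDiffAt_const.mul hk).mul (hs.mul contDiffAt_const)).mul hA1)),
    ((hAc.mul hN).mul hw).mul (hAz.add (hA1.mul (hΦz.add
      ((contDiffAt_const.mul (contDiffAt_conj (n := 1) hs)).mul hm))))⟩

/-- The twisted Bochner–Kodaira identity, pointwise: up to a divergence, the twisted norms of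
`∂A/∂z̄` and of the adjoint derivative of `A` differ by curvature terms. -/
lemma wirtinger_twistField (hρ : 0 < ρ) (h0 : 0 < shiftedSq a η ρ z) (h1 : shiftedSq a η ρ z < 1)
    (hΦ : ContDiffAt ℝ 2 Φ z) (hA : ContDiffAt ℝ 2 A z) :
    wirtingerZ (twistFieldZ a η ρ Φ A) z - wirtingerZBar (twistFieldZBar a η ρ Φ A) z =
      ((twistDensity a η ρ Φ z *
        (twistWeight (shiftedSq a η ρ z) * Complex.normSq (wirtingerZBar A z)
        - 2 * twistSlope (shiftedSq a η ρ z) * ((z - a) / ρ * A z * conj (wirtingerZBar A z)).re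
        - twistWeight (shiftedSq a η ρ z) * Complex.normSq (wirtingerZ A z + A z *
          (wirtingerZ (fun z => (Φ z : ℂ)) z +
            (1 / ρ : ℂ) * conj (z - a) * ((1 / (1 - shiftedSq a η ρ z) : ℝ) : ℂ)))
        - twistWeight (shiftedSq a η ρ z) * ddbarCoeff Φ z * Complex.normSq (A z)
        - Complex.normSq (A z) * (twistSlope (shiftedSq a η ρ z) / (1 - shiftedSq a η ρ z) *
            (Complex.normSq (z - a) / ρ ^ 2) + η / (ρ ^ 2 * shiftedSq a η ρ z ^ 2))) : ℝ) : ℂ) := by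
  have hAd : DifferentiableAt ℝ A z := hA.differentiableAt (by norm_num)
  have hy : DifferentiableAt ℝ (shiftedSq a η ρ) z :=
    (contDiff_shiftedSq a η ρ (n := 1)).differentiable (by norm_num) z
  have hw : DifferentiableAt ℝ (fun z => (twistWeight (shiftedSq a η ρ z) : ℂ)) z :=
    Complex.ofRealCLM.differentiableAt.comp z
      ((hasDerivAt_twistWeight h0 h1).differentiableAt.comp z hy)
  have hk : DifferentiableAt ℝ (fun z => (twistSlope (shiftedSq a η ρ z) : ℂ)) z :=
    Complex.ofRealCLM.differentiableAt.comp z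
      ((hasDerivAt_twistSlope h0 h1).differentiableAt.comp z hy)
  have hmr : HasDerivAt (fun t : ℝ => 1 / (1 - t)) (1 / (1 - shiftedSq a η ρ z) ^ 2)
      (shiftedSq a η ρ z) := hasDerivAt_one_div_one_sub h1
  have hm : DifferentiableAt ℝ (fun z => ((1 / (1 - shiftedSq a η ρ z) : ℝ) : ℂ)) z :=
    Complex.ofRealCLM.differentiableAt.comp z (hmr.differentiableAt.comp z hy)
  have hN : DifferentiableAt ℝ (fun z => (twistDensity a η ρ Φ z : ℂ)) z :=
    (contDiffAt_ofReal_comp (n := 2) (contDiffAt_twistDensity h1 (n := 2) hΦ)).differentiableAt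
      (by norm_num)
  have hs : DifferentiableAt ℝ (fun z : ℂ => z - a) z := by fun_prop
  have hsc := differentiableAt_conj_sub a z
  have hc : ∀ c : ℂ, DifferentiableAt ℝ (fun _ : ℂ => c) z := fun c => differentiableAt_const c
  have hAc : DifferentiableAt ℝ (fun z => conj (A z)) z :=
    Complex.conjCLE.differentiableAt.comp z hAd
  have hΦz : DifferentiableAt ℝ (wirtingerZ fun z => (Φ z : ℂ)) z :=
    ((contDiffAt_ofReal_comp (n := 2) hΦ).wirtingerZ (m := 1) (n := 2)
      (by norm_num)).differentiableAt (by norm_num)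
  have hAz : DifferentiableAt ℝ (wirtingerZ A) z :=
    (hA.wirtingerZ (m := 1) (n := 2) (by norm_num)).differentiableAt (by norm_num)
  have hAzb : DifferentiableAt ℝ (wirtingerZBar A) z :=
    (hA.wirtingerZBar (m := 1) (n := 2) (by norm_num)).differentiableAt (by norm_num)
  have hcz : ∀ c : ℂ, wirtingerZ (fun _ : ℂ => c) z = 0 := fun c => by simp [wirtingerZ]
  have hczb : ∀ c : ℂ, wirtingerZBar (fun _ : ℂ => c) z = 0 := fun c => by simp [wirtingerZBar]
  obtain ⟨N1, N2⟩ := wirtinger_twistDensity h1 hΦ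
  have hQ := hΦz.fun_add (((hc (1 / ρ : ℂ)).fun_mul hsc).fun_mul hm)
  have hT := ((hc (-1)).fun_mul hk).fun_mul (hs.fun_mul (hc (1 / ρ : ℂ)))
  have hΦb : wirtingerZBar (fun z => (Φ z : ℂ)) z = conj (wirtingerZ (fun z => (Φ z : ℂ)) z) := by
    rw [wirtingerZ_ofReal, Complex.conj_conj]
    exact (contDiffAt_ofReal_comp (n := 2) hΦ).differentiableAt (by norm_num)
  unfold twistFieldZ twistFieldZBar
  rw [wirtingerZ_mul (hAc.fun_mul hN) ((hw.fun_mul hAzb).fun_add (hT.fun_mul hAd)),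
    wirtingerZ_mul hAc hN, wirtingerZ_add (hw.fun_mul hAzb) (hT.fun_mul hAd),
    wirtingerZ_mul hw hAzb, wirtingerZ_mul hT hAd,
    wirtingerZ_mul ((hc _).fun_mul hk) (hs.fun_mul (hc _)), wirtingerZ_mul (hc _) hk,
    wirtingerZ_mul hs (hc _), hcz, hcz, wirtingerZ_sub_const, N1, wirtingerZ_conj hAd,
    wirtingerZ_ofReal_comp (hasDerivAt_twistWeight h0 h1) hy,
    wirtingerZ_ofReal_comp (hasDerivAt_twistSlope h0 h1) hy, wirtingerZ_shiftedSq,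
    wirtingerZBar_mul ((hAc.fun_mul hN).fun_mul hw) (hAz.fun_add (hAd.fun_mul hQ)),
    wirtingerZBar_mul (hAc.fun_mul hN) hw, wirtingerZBar_mul hAc hN,
    wirtingerZBar_add hAz (hAd.fun_mul hQ), wirtingerZBar_mul hAd hQ,
    wirtingerZBar_add hΦz (((hc _).fun_mul hsc).fun_mul hm),
    wirtingerZBar_mul ((hc _).fun_mul hsc) hm,
    wirtingerZBar_mul (hc _) hsc, hczb, N2, wirtingerZBar_conj hAd, wirtingerZBar_conj hs,
    wirtingerZ_sub_const, wirtingerZBar_wirtingerZ_ofReal hΦ, wirtingerZBar_wirtingerZ hA,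
    wirtingerZBar_ofReal_comp (hasDerivAt_twistWeight h0 h1) hy,
    wirtingerZBar_ofReal_comp (ω := fun t : ℝ => 1 / (1 - t)) hmr hy, wirtingerZBar_shiftedSq, hΦb]
  have hzz : (z - a) * conj (z - a) = ρ * shiftedSq a η ρ z - η := by
    have hyd : Complex.normSq (z - a) = ρ * shiftedSq a η ρ z - η := by
      simp only [shiftedSq]; field_simp; ring
    rw [Complex.mul_conj, hyd]; push_cast; ring
  have h1' : (1 - shiftedSq a η ρ z : ℂ) ≠ 0 := by
    norm_cast; linarith
  have h0' : (shiftedSq a η ρ z : ℂ) ≠ 0 := by norm_cast; linarith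
  have hρ' : (ρ : ℂ) ≠ 0 := by norm_cast; linarith
  have hκ : (twistSlope (shiftedSq a η ρ z) : ℂ) =
      1 / shiftedSq a η ρ z - twistWeight (shiftedSq a η ρ z) / (1 - shiftedSq a η ρ z) := by
    simp [twistSlope]
  have hη : (η : ℂ) = ρ * shiftedSq a η ρ z - (z - a) * conj (z - a) := by rw [hzz]; ring
  have hre : ∀ u : ℂ, (u.re : ℂ) = (u + conj u) / 2 := fun u => by
    rw [Complex.add_conj]; push_cast; ring
  push_cast
  simp only [hre, ← Complex.mul_conj, map_add, map_mul, map_div₀, Complex.conj_conj,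
    Complex.conj_ofReal, map_sub, map_one] at *
  rw [hη]
  generalize (twistSlope (shiftedSq a η ρ z) : ℂ) = κ at *
  generalize (twistWeight (shiftedSq a η ρ z) : ℂ) = w at *
  generalize (shiftedSq a η ρ z : ℂ) = y at *
  generalize (twistDensity a η ρ Φ z : ℂ) = N at *
  generalize wirtingerZ (wirtingerZBar A) z = A12
  generalize wirtingerZ A z = A1
  generalize wirtingerZBar A z = A2
  generalize wirtingerZ (fun z => (Φ z : ℂ)) z = P
  generalize conj P = Pb
  generalize conj A1 = A1b
  generalize conj A2 = A2b
  generalize conj (A z) = Ab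
  generalize A z = A0
  rw [hκ]
  clear * - h1' h0' hρ'
  field_simp
  ring

/-- The integrand of the twisted basic estimate: in `wirtinger_twistField` drop the square and the
curvature term of `Φ`, and absorb the cross term by Cauchy–Schwarz into the curvature of the twist.
The identity `w + κ (1 - y) = (1 - y) / y` for the weight `w` and its slope `-κ` turns the total
coefficient of `|∂A/∂z̄|²` into `1 / y`. -/
lemma re_wirtinger_twistField_le (hη : 0 < η) (hρ : 0 < ρ) (h0 : 0 < shiftedSq a η ρ z)
    (h1 : shiftedSq a η ρ z < 1)
    (hΦ : ContDiffAt ℝ 2 Φ z) (hsub : 0 ≤ ddbarCoeff Φ z) (hA : ContDiffAt ℝ 2 A z) :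
    (wirtingerZ (twistFieldZ a η ρ Φ A) z - wirtingerZBar (twistFieldZBar a η ρ Φ A) z).re ≤
      Real.exp (Φ z) * (ρ * ‖wirtingerZBar A z‖ ^ 2 / (Complex.normSq (z - a) + η)
        - η * ‖A z‖ ^ 2 / (Complex.normSq (z - a) + η) ^ 2) := by
  rw [wirtinger_twistField hρ h0 h1 hΦ hA, Complex.ofReal_re]
  have hd : Complex.normSq (z - a) + η = ρ * shiftedSq a η ρ z := by
    simp only [shiftedSq]; field_simp
  rw [hd]
  set y := shiftedSq a η ρ z
  have hw := twistWeight_nonneg h0 h1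
  have hk := twistSlope_nonneg h0 h1
  have hwk := twistWeight_add_twistSlope h0 h1
  have h1' : 0 < 1 - y := by linarith
  have hN : twistDensity a η ρ Φ z = Real.exp (Φ z) * (1 / (1 - y)) := rfl
  rw [hN, mul_assoc]
  refine mul_le_mul_of_nonneg_left ?_ (Real.exp_pos _).le
  have hcs : -(2 * ((z - a) / ρ * A z * conj (wirtingerZBar A z)).re) ≤
      Complex.normSq (A z) / (1 - y) * (Complex.normSq (z - a) / ρ ^ 2) +
        (1 - y) * Complex.normSq (wirtingerZBar A z) := by
    have h := Complex.abs_re_le_norm ((z - a) / ρ * A z * conj (wirtingerZBar A z))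
    rw [norm_mul, norm_mul, norm_div, Complex.norm_conj, Complex.norm_real, Real.norm_eq_abs,
      abs_of_pos hρ] at h
    simp only [Complex.normSq_eq_norm_sq]
    have h2 := neg_abs_le ((z - a) / ρ * A z * conj (wirtingerZBar A z)).re
    have h3 := sq_nonneg (‖z - a‖ / ρ * ‖A z‖ - (1 - y) * ‖wirtingerZBar A z‖)
    have h4 : 2 * (‖z - a‖ / ρ * ‖A z‖ * ‖wirtingerZBar A z‖) ≤
      ‖A z‖ ^ 2 / (1 - y) * (‖z - a‖ ^ 2 / ρ ^ 2) + (1 - y) * ‖wirtingerZBar A z‖ ^ 2 := by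
      have : 0 ≤ (‖z - a‖ / ρ * ‖A z‖ - (1 - y) * ‖wirtingerZBar A z‖) ^ 2 / (1 - y) := by
        positivity
      have e : (‖z - a‖ / ρ * ‖A z‖ - (1 - y) * ‖wirtingerZBar A z‖) ^ 2 / (1 - y) =
        ‖A z‖ ^ 2 / (1 - y) * (‖z - a‖ ^ 2 / ρ ^ 2) + (1 - y) * ‖wirtingerZBar A z‖ ^ 2
          - 2 * (‖z - a‖ / ρ * ‖A z‖ * ‖wirtingerZBar A z‖) := by
        field_simp; ring
      linarith
    linarith
  have hcs' := mul_le_mul_of_nonneg_left hcs hk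
  have hsq := mul_nonneg hw (Complex.normSq_nonneg (wirtingerZ A z + A z *
          (wirtingerZ (fun z => (Φ z : ℂ)) z +
            (1 / ρ : ℂ) * conj (z - a) * ((1 / (1 - y) : ℝ) : ℂ))))
  have hdd := mul_nonneg (mul_nonneg hw hsub) (Complex.normSq_nonneg (A z))
  have hη' : 1 * (η * Complex.normSq (A z) / (ρ * y) ^ 2) ≤
      (1 / (1 - y)) * (η * Complex.normSq (A z) / (ρ * y) ^ 2) := by
    refine mul_le_mul_of_nonneg_right ?_ (div_nonneg (mul_nonneg hη.le (Complex.normSq_nonneg _))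
      (by positivity))
    rw [le_div_iff₀ h1']; linarith
  calc _ ≤ 1 / (1 - y) * ((twistWeight y + twistSlope y * (1 - y)) *
        Complex.normSq (wirtingerZBar A z) - η * Complex.normSq (A z) / (ρ * y) ^ 2) := by
        refine mul_le_mul_of_nonneg_left ?_ (by positivity)
        have e1 : Complex.normSq (A z) * (twistSlope y / (1 - y) *
            (Complex.normSq (z - a) / ρ ^ 2) + η / (ρ ^ 2 * y ^ 2)) =
          twistSlope y * (Complex.normSq (A z) / (1 - y) * (Complex.normSq (z - a) / ρ ^ 2)) +
            η * Complex.normSq (A z) / (ρ * y) ^ 2 := by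
          field_simp
        rw [e1]
        linarith
    _ = Complex.normSq (wirtingerZBar A z) / y -
        1 / (1 - y) * (η * Complex.normSq (A z) / (ρ * y) ^ 2) := by
        rw [hwk]; field_simp
    _ ≤ _ := by
        simp only [Complex.normSq_eq_norm_sq] at hη' ⊢
        have e2 : ρ * ‖wirtingerZBar A z‖ ^ 2 / (ρ * y) = ‖wirtingerZBar A z‖ ^ 2 / y := by
          field_simp
        rw [e2]; linarith

lemma contDiff_of_forall_mem_isClosed {n : ℕ∞} {V : ℂ → ℂ} {K : Set ℂ} (hK : IsClosed K)
    (h : ∀ z ∈ K, ContDiffAt ℝ n V z) (h0 : ∀ z ∉ K, V z = 0) : ContDiff ℝ n V := by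
  refine contDiff_iff_contDiffAt.2 fun z => ?_
  by_cases hz : z ∈ K
  · exact h z hz
  · exact contDiffAt_const.congr_of_eventuallyEq (f := fun _ => (0 : ℂ))
      (Filter.mem_of_superset (hK.isOpen_compl.mem_nhds hz) fun w hw => h0 w hw)

lemma integrable_of_continuousOn_of_forall_notMem {E : Type*} [NormedAddCommGroup E]
    {f : ℂ → E} {K : Set ℂ} (hK : IsCompact K)
    (h : ContinuousOn f K) (h0 : ∀ z ∉ K, f z = 0) : Integrable f := by
  have : K.indicator f = f := Set.indicator_eq_self.2 fun z hz => by
    by_contra hzK; exact hz (h0 z hzK)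
  rw [← this, integrable_indicator_iff hK.measurableSet]
  exact h.integrableOn_compact hK

end Twist

/-- The basic estimate with regularised singularity at `a`: for a subharmonic weight `Φ` on
`Δ(a; √ρ)` and a test function `A` supported where `|z - a|² + η < ρ`. -/
lemma basic_estimate {a : ℂ} {η ρ : ℝ} (hη : 0 < η) (hρ : 0 < ρ) {Φ : ℂ → ℝ} {A : ℂ → ℂ}
    (hA : ContDiff ℝ 2 A) (hAc : HasCompactSupport A)
    (hsupp : ∀ z ∈ tsupport A, Complex.normSq (z - a) + η < ρ)
    (hΦ : ∀ z ∈ tsupport A, ContDiffAt ℝ 2 Φ z) (hsub : ∀ z ∈ tsupport A, 0 ≤ ddbarCoeff Φ z) :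
    ∫ z, Real.exp (Φ z) * (η * ‖A z‖ ^ 2 / (Complex.normSq (z - a) + η) ^ 2) ≤
      ∫ z, Real.exp (Φ z) * (ρ * ‖wirtingerZBar A z‖ ^ 2 / (Complex.normSq (z - a) + η)) := by
  have hd : ∀ z, 0 < Complex.normSq (z - a) + η := fun z =>
    add_pos_of_nonneg_of_pos (Complex.normSq_nonneg _) hη
  have hy0 : ∀ z, 0 < shiftedSq a η ρ z := fun z => div_pos (hd z) hρ
  have hy1 : ∀ z ∈ tsupport A, shiftedSq a η ρ z < 1 := fun z hz => by
    rw [shiftedSq, div_lt_one hρ]; exact hsupp z hz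
  have hA0 : ∀ z ∉ tsupport A, A z = 0 := fun z hz => image_eq_zero_of_notMem_tsupport hz
  have hAb0 : ∀ z ∉ tsupport A, wirtingerZBar A z = 0 := fun z hz =>
    image_eq_zero_of_notMem_tsupport fun h => hz (tsupport_wirtingerZBar_subset A h)
  have hz1 : ∀ z ∉ tsupport A, twistFieldZ a η ρ Φ A z = 0 := fun z hz => by
    simp [twistFieldZ, hA0 z hz]
  have hz2 : ∀ z ∉ tsupport A, twistFieldZBar a η ρ Φ A z = 0 := fun z hz => by
    simp [twistFieldZBar, hA0 z hz]
  have hC := fun z hz => contDiffAt_twistField (hy0 z) (hy1 z hz) (hΦ z hz) hA.contDiffAt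
  have hV1 : ContDiff ℝ 1 (twistFieldZ a η ρ Φ A) :=
    contDiff_of_forall_mem_isClosed (n := 1) (isClosed_tsupport A) (fun z hz => (hC z hz).1) hz1
  have hV2 : ContDiff ℝ 1 (twistFieldZBar a η ρ Φ A) :=
    contDiff_of_forall_mem_isClosed (n := 1) (isClosed_tsupport A) (fun z hz => (hC z hz).2) hz2
  have hc1 : HasCompactSupport (twistFieldZ a η ρ Φ A) := HasCompactSupport.intro hAc hz1
  have hc2 : HasCompactSupport (twistFieldZBar a η ρ Φ A) := HasCompactSupport.intro hAc hz2
  have i1 := hV1.continuous_wirtingerZ.integrable_of_hasCompactSupport hc1.wirtingerZ (μ := volume)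
  have i2 := hV2.continuous_wirtingerZBar.integrable_of_hasCompactSupport hc2.wirtingerZBar
    (μ := volume)
  have hΦc : ContinuousOn (fun z => Real.exp (Φ z)) (tsupport A) := fun z hz =>
    (hΦ z hz).continuousAt.continuousWithinAt.rexp
  have hn : Continuous fun z => Complex.normSq (z - a) + η :=
    (Complex.continuous_normSq.comp (continuous_id.sub continuous_const)).add continuous_const
  have hAbc := (hA.of_le (by norm_num : (1 : WithTop ℕ∞) ≤ 2)).continuous_wirtingerZBar
  have j1 : Integrable fun z =>
      Real.exp (Φ z) * (η * ‖A z‖ ^ 2 / (Complex.normSq (z - a) + η) ^ 2) := by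
    refine integrable_of_continuousOn_of_forall_notMem hAc (hΦc.mul (Continuous.continuousOn ?_))
      fun z hz => by simp [hA0 z hz]
    exact (continuous_const.mul (hA.continuous.norm.pow 2)).div (hn.pow 2)
      fun z => (pow_pos (hd z) 2).ne'
  have j2 : Integrable fun z =>
      Real.exp (Φ z) * (ρ * ‖wirtingerZBar A z‖ ^ 2 / (Complex.normSq (z - a) + η)) := by
    refine integrable_of_continuousOn_of_forall_notMem hAc (hΦc.mul (Continuous.continuousOn ?_))
      fun z hz => by simp [hAb0 z hz]
    exact (continuous_const.mul (hAbc.norm.pow 2)).div hn fun z => (hd z).ne'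
  have h0 : ∫ z, (wirtingerZ (twistFieldZ a η ρ Φ A) z -
      wirtingerZBar (twistFieldZBar a η ρ Φ A) z).re = 0 := by
    have := integral_re (𝕜 := ℂ) (i1.sub i2)
    simp only [Pi.sub_apply, RCLike.re_to_complex] at this
    rw [this, integral_sub i1 i2, integral_wirtingerZ_eq_zero hV1 hc1,
      integral_wirtingerZBar_eq_zero hV2 hc2]
    simp
  have hle : ∫ z, (wirtingerZ (twistFieldZ a η ρ Φ A) z -
      wirtingerZBar (twistFieldZBar a η ρ Φ A) z).re ≤
      ∫ z, (Real.exp (Φ z) * (ρ * ‖wirtingerZBar A z‖ ^ 2 / (Complex.normSq (z - a) + η)) -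
        Real.exp (Φ z) * (η * ‖A z‖ ^ 2 / (Complex.normSq (z - a) + η) ^ 2)) := by
    refine integral_mono (i1.sub i2).re (j2.sub j1) fun z => ?_
    by_cases hz : z ∈ tsupport A
    · have := re_wirtinger_twistField_le hη hρ (hy0 z) (hy1 z hz) (hΦ z hz) (hsub z hz)
        hA.contDiffAt
      simpa only [mul_sub, RCLike.re_to_complex, Pi.sub_apply] using this
    · have e1 : wirtingerZ (twistFieldZ a η ρ Φ A) z = 0 := by
        have := fderiv_of_notMem_tsupport (𝕜 := ℝ) (fun h => hz (closure_minimal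
          (fun w hw => by by_contra h'; exact hw (hz1 w h')) (isClosed_tsupport A) h) :
            z ∉ tsupport (twistFieldZ a η ρ Φ A))
        simp [wirtingerZ, this]
      have e2 : wirtingerZBar (twistFieldZBar a η ρ Φ A) z = 0 := by
        have := fderiv_of_notMem_tsupport (𝕜 := ℝ) (fun h => hz (closure_minimal
          (fun w hw => by by_contra h'; exact hw (hz2 w h')) (isClosed_tsupport A) h) :
            z ∉ tsupport (twistFieldZBar a η ρ Φ A))
        simp [wirtingerZBar, this]
      simp [e1, e2, hA0 z hz, hAb0 z hz]
  rw [h0, integral_sub j2 j1] at hle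
  linarith

/-! ### The kernel `η / (|z - a|² + η)²` as an approximate identity -/

lemma volume_real_ball_complex {a : ℂ} {r : ℝ} (hr : 0 ≤ r) :
    (volume : Measure ℂ).real (Metric.ball a r) = Real.pi * r ^ 2 := by
  rw [measureReal_def, Complex.volume_ball]
  simp [hr]; ring

lemma integral_inv_one_add_sq_sq : ∫ z : ℂ, Real.pi⁻¹ / (1 + ‖z‖ ^ 2) ^ 2 = 1 := by
  rw [integral_fun_norm_addHaar (volume : Measure ℂ) (fun t : ℝ => Real.pi⁻¹ / (1 + t ^ 2) ^ 2),
    volume_real_ball_complex zero_le_one, Complex.finrank_real_complex]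
  have hd : ∀ t ∈ Set.Ici (0 : ℝ), HasDerivAt (fun t : ℝ => -(Real.pi⁻¹ / 2) * (1 + t ^ 2)⁻¹)
      (t ^ (2 - 1) • (Real.pi⁻¹ / (1 + t ^ 2) ^ 2)) t := by
    intro t _
    have h : (1 + t ^ 2) ≠ 0 := by positivity
    have := (((hasDerivAt_pow 2 t).const_add 1).inv h).const_mul (-(Real.pi⁻¹ / 2))
    refine this.congr_deriv ?_
    simp; field_simp
  have ht : Tendsto (fun t : ℝ => -(Real.pi⁻¹ / 2) * (1 + t ^ 2)⁻¹) atTop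
      (𝓝 (-(Real.pi⁻¹ / 2) * 0)) :=
    (tendsto_inv_atTop_zero.comp
      (tendsto_atTop_add_const_left _ _ (tendsto_pow_atTop two_ne_zero))).const_mul _
  rw [integral_Ioi_of_hasDerivAt_of_nonneg' hd (fun t ht => ?_) ht]
  · simp; field_simp
  · have : (0:ℝ) < t := ht
    simp only [smul_eq_mul]; positivity

/-- The normalised kernels `c⁻² / (|z - a|² + c⁻²)²` have total mass `π` and concentrate at `a`. -/
lemma tendsto_integral_peak {E : Type*} [NormedAddCommGroup E] [NormedSpace ℝ E] [CompleteSpace E]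
    {g : ℂ → E} (hg : Integrable g) {a : ℂ} (ha : ContinuousAt g a) :
    Tendsto (fun c : ℝ => ∫ z, ((c ^ 2)⁻¹ / (Complex.normSq (z - a) + (c ^ 2)⁻¹) ^ 2) • g z) atTop
      (𝓝 (Real.pi • g a)) := by
  have hdec : Tendsto (fun x : ℂ => ‖x‖ ^ Module.finrank ℝ ℂ * (Real.pi⁻¹ / (1 + ‖x‖ ^ 2) ^ 2))
      (Bornology.cobounded ℂ) (𝓝 0) := by
    rw [Complex.finrank_real_complex]
    have h1 : Tendsto (fun x : ℂ => Real.pi⁻¹ * (1 + ‖x‖ ^ 2)⁻¹) (Bornology.cobounded ℂ)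
        (𝓝 (Real.pi⁻¹ * 0)) :=
      (tendsto_inv_atTop_zero.comp (tendsto_atTop_add_const_left _ _
        ((tendsto_pow_atTop two_ne_zero).comp tendsto_norm_cobounded_atTop))).const_mul _
    rw [mul_zero] at h1
    refine squeeze_zero (fun x => by positivity) (fun x => ?_) h1
    have : 0 < 1 + ‖x‖ ^ 2 := by positivity
    rw [← sub_nonneg]
    have e : Real.pi⁻¹ * (1 + ‖x‖ ^ 2)⁻¹ - ‖x‖ ^ 2 * (Real.pi⁻¹ / (1 + ‖x‖ ^ 2) ^ 2) =
      Real.pi⁻¹ / (1 + ‖x‖ ^ 2) ^ 2 := by field_simp; ring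
    rw [e]; positivity
  have h := (tendsto_integral_comp_smul_smul_of_integrable' (μ := volume) (x₀ := a)
    (φ := fun x : ℂ => Real.pi⁻¹ / (1 + ‖x‖ ^ 2) ^ 2) (fun x => by positivity)
    integral_inv_one_add_sq_sq hdec hg ha).const_smul Real.pi
  refine h.congr' ?_
  filter_upwards [eventually_gt_atTop 0] with c hc
  rw [← integral_smul]
  refine integral_congr_ae (Eventually.of_forall fun z => ?_)
  simp only [smul_smul, Complex.finrank_real_complex]
  congr 1
  rw [norm_smul, norm_sub_rev, Real.norm_eq_abs, abs_of_pos hc, Complex.normSq_eq_norm_sq]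
  field_simp
  ring

/-- The sharp basic estimate: if `A_z̄ = (z - a) k` with `A` a test function on `Δ(a; r)` and `Φ`
is subharmonic there, then `π |A(a)|² e^{Φ(a)} ≤ r² ∫ |k|² e^Φ`. -/
lemma sharp_basic_estimate {a : ℂ} {r : ℝ} (hr : 0 < r) {Φ : ℂ → ℝ} {A k : ℂ → ℂ}
    (hΦ : ∀ z ∈ Metric.ball a r, ContDiffAt ℝ 2 Φ z)
    (hsub : ∀ z ∈ Metric.ball a r, 0 ≤ ddbarCoeff Φ z)
    (hA : ContDiff ℝ 2 A) (hAc : HasCompactSupport A) (hsupp : tsupport A ⊆ Metric.ball a r)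
    (hk : Continuous k) (hkc : HasCompactSupport k) (hks : tsupport k ⊆ Metric.ball a r)
    (hAk : ∀ z, wirtingerZBar A z = (z - a) * k z) :
    Real.pi * (Real.exp (Φ a) * ‖A a‖ ^ 2) ≤ r ^ 2 * ∫ z, Real.exp (Φ z) * ‖k z‖ ^ 2 := by
  have hΦc : ContinuousOn (fun z => Real.exp (Φ z)) (Metric.ball a r) := fun z hz =>
    (hΦ z hz).continuousAt.continuousWithinAt.rexp
  have ig : Integrable fun z => Real.exp (Φ z) * ‖A z‖ ^ 2 :=
    integrable_of_continuousOn_of_forall_notMem hAc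
      ((hΦc.mono hsupp).mul (hA.continuous.norm.pow 2).continuousOn)
      fun z hz => by simp [image_eq_zero_of_notMem_tsupport hz]
  have ik : Integrable fun z => Real.exp (Φ z) * ‖k z‖ ^ 2 :=
    integrable_of_continuousOn_of_forall_notMem hkc
      ((hΦc.mono hks).mul (hk.norm.pow 2).continuousOn)
      fun z hz => by simp [image_eq_zero_of_notMem_tsupport hz]
  have hca : ContinuousAt (fun z => Real.exp (Φ z) * ‖A z‖ ^ 2) a :=
    ((hΦ a (Metric.mem_ball_self hr)).continuousAt.rexp).mul (hA.continuous.norm.pow 2).continuousAt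
  obtain ⟨r', ⟨hr'0, hr'⟩, hs'⟩ := exists_pos_lt_subset_ball hr (isClosed_tsupport A) hsupp
  refine le_of_tendsto (tendsto_integral_peak ig hca) ?_
  have hsmall : ∀ᶠ c : ℝ in atTop, (c ^ 2)⁻¹ < r ^ 2 - r' ^ 2 :=
    (tendsto_inv_atTop_zero.comp (tendsto_pow_atTop two_ne_zero)).eventually_lt_const
      (by nlinarith)
  filter_upwards [hsmall, eventually_gt_atTop 0] with c hc hc0
  have hη : 0 < (c ^ 2)⁻¹ := by positivity
  have hb := basic_estimate (a := a) hη (pow_pos hr 2) hA hAc (fun z hz => by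
    have : ‖z - a‖ < r' := by simpa [dist_eq_norm] using hs' hz
    rw [Complex.normSq_eq_norm_sq]
    nlinarith [norm_nonneg (z - a)]) (fun z hz => hΦ z (hsupp hz)) fun z hz => hsub z (hsupp hz)
  have hd : ∀ z, 0 < Complex.normSq (z - a) + (c ^ 2)⁻¹ := fun z =>
    add_pos_of_nonneg_of_pos (Complex.normSq_nonneg _) hη
  calc _ = ∫ z, Real.exp (Φ z) * ((c ^ 2)⁻¹ * ‖A z‖ ^ 2 /
        (Complex.normSq (z - a) + (c ^ 2)⁻¹) ^ 2) := by
        refine integral_congr_ae (Eventually.of_forall fun z => ?_)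
        simp only [smul_eq_mul]; ring
    _ ≤ _ := hb
    _ ≤ ∫ z, r ^ 2 * (Real.exp (Φ z) * ‖k z‖ ^ 2) := by
        refine integral_mono_of_nonneg (Eventually.of_forall fun z => ?_) (ik.const_mul _)
          (Eventually.of_forall fun z => ?_)
        · have := hd z
          positivity
        · have hd' := hd z
          simp only [hAk, norm_mul, mul_pow, ← Complex.normSq_eq_norm_sq (z - a)]
          rw [mul_left_comm (r ^ 2) (Real.exp (Φ z))]
          refine mul_le_mul_of_nonneg_left ?_ (Real.exp_pos _).le
          rw [div_le_iff₀ hd']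
          have : 0 ≤ r ^ 2 * ‖k z‖ ^ 2 * (c ^ 2)⁻¹ := by positivity
          linarith
    _ = _ := integral_const_mul _ _

/-! ### The Cauchy kernel -/

lemma integrable_div_sub {h : ℂ → ℂ} (hc : Continuous h) (hs : HasCompactSupport h) (a : ℂ) :
    Integrable fun z => h z / (z - a) := by
  obtain ⟨C, hC⟩ := hc.bounded_above_of_compact_support hs
  obtain ⟨R, hR⟩ := hs.isBounded.subset_ball a
  have hI : Integrable (fun z : ℂ => Set.indicator (Set.Iio R) (fun t : ℝ => C / t) ‖z‖) := by
    rw [integrable_fun_norm_addHaar (volume : Measure ℂ)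
      (f := Set.indicator (Set.Iio R) fun t : ℝ => C / t), Complex.finrank_real_complex]
    have : IntegrableOn (fun _ : ℝ => C) (Set.Ioo 0 R) := by simp
    rw [← integrable_indicator_iff measurableSet_Ioi]
    rw [← integrable_indicator_iff measurableSet_Ioo] at this
    refine this.congr (Eventually.of_forall fun t => ?_)
    by_cases h0 : 0 < t <;> by_cases h1 : t < R <;> simp [Set.indicator, h0, h1]
    field_simp
  refine (hI.comp_sub_right a).mono' (by
    exact (hc.measurable.div (measurable_id.sub_const a)).aestronglyMeasurable) ?_
  refine Eventually.of_forall fun z => ?_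
  by_cases hz : z ∈ tsupport h
  · have : ‖z - a‖ < R := by simpa [dist_eq_norm] using hR hz
    simp only [Set.indicator, Set.mem_Iio, this, if_true, norm_div]
    exact div_le_div_of_nonneg_right (hC z) (norm_nonneg _)
  · rw [image_eq_zero_of_notMem_tsupport hz]
    simp only [zero_div, norm_zero, Set.indicator]
    split_ifs
    · exact div_nonneg ((norm_nonneg _).trans (hC z)) (norm_nonneg _)
    · exact le_rfl

/-- Cauchy–Pompeiu for compactly supported functions: integrate `∂/∂z̄` of `G` times the regularised
kernel `conj (z - a) / (|z - a|² + η)`, and let `η → 0`. -/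
lemma integral_wirtingerZBar_div_sub {G : ℂ → ℂ} (hG : ContDiff ℝ 1 G) (hc : HasCompactSupport G)
    (a : ℂ) : ∫ z, wirtingerZBar G z / (z - a) = -(Real.pi * G a) := by
  have hGb := hG.continuous_wirtingerZBar
  have hGbc := hc.wirtingerZBar
  have hgI : Integrable G := hG.continuous.integrable_of_hasCompactSupport hc
  have h1 := (tendsto_integral_peak hgI (a := a) hG.continuous.continuousAt).neg
  have h2 : Tendsto (fun c : ℝ => ∫ z, wirtingerZBar G z *
      (conj (z - a) * ((1 / (Complex.normSq (z - a) + (c ^ 2)⁻¹) : ℝ) : ℂ))) atTop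
      (𝓝 (∫ z, wirtingerZBar G z / (z - a))) := by
    refine tendsto_integral_filter_of_dominated_convergence
      (fun z => ‖wirtingerZBar G z / (z - a)‖) ?_ ?_ (integrable_div_sub hGb hGbc a).norm ?_
    · refine Eventually.of_forall fun c => Measurable.aestronglyMeasurable ?_
      have := hGb.measurable
      have : Measurable fun z : ℂ => Complex.normSq (z - a) :=
        (Complex.continuous_normSq.comp (continuous_id.sub continuous_const)).measurable
      have : Measurable fun z : ℂ => conj (z - a) :=
        (Complex.continuous_conj.comp (continuous_id.sub continuous_const)).measurable
      fun_prop
    · filter_upwards [eventually_gt_atTop 0] with c hc0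
      refine Eventually.of_forall fun z => ?_
      have hη : 0 < (c ^ 2)⁻¹ := by positivity
      have hd : 0 < ‖z - a‖ ^ 2 + (c ^ 2)⁻¹ := by positivity
      rw [norm_mul, norm_mul, norm_div, div_eq_mul_inv, Complex.norm_conj, Complex.norm_real,
        Complex.normSq_eq_norm_sq, Real.norm_eq_abs, abs_of_pos (by positivity)]
      refine mul_le_mul_of_nonneg_left ?_ (norm_nonneg _)
      rcases (norm_nonneg (z - a)).eq_or_lt with h | h
      · simp [← h]
      · rw [one_mul, ← div_eq_mul_inv, div_le_iff₀ hd, mul_add, ← sub_nonneg]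
        have : ‖z - a‖⁻¹ * ‖z - a‖ ^ 2 + ‖z - a‖⁻¹ * (c ^ 2)⁻¹ - ‖z - a‖ =
          ‖z - a‖⁻¹ * (c ^ 2)⁻¹ := by field_simp; ring
        rw [this]; positivity
    · refine Eventually.of_forall fun z => ?_
      rcases eq_or_ne z a with rfl | hza
      · simp
      have hn : Complex.normSq (z - a) ≠ 0 := by simpa [sub_eq_zero] using hza
      have e : wirtingerZBar G z / (z - a) =
          wirtingerZBar G z * (conj (z - a) * ((1 / (Complex.normSq (z - a) + 0) : ℝ) : ℂ)) := by
        rw [add_zero, Complex.ofReal_div, ← Complex.mul_conj]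
        have h1 : z - a ≠ 0 := sub_ne_zero.2 hza
        have h2 : conj (z - a) ≠ 0 := (map_ne_zero _).2 h1
        field_simp; simp
      rw [e]
      refine Tendsto.const_mul _ (Tendsto.const_mul _
        ((Complex.continuous_ofReal.tendsto _).comp (Tendsto.div tendsto_const_nhds
          (Tendsto.const_add _ (tendsto_inv_atTop_zero.comp (tendsto_pow_atTop two_ne_zero)))
          (by simpa using hn))))
  refine tendsto_nhds_unique h2 ?_
  have e3 : -(Real.pi * G a : ℂ) = -(Real.pi • G a) := by simp
  rw [e3]
  refine h1.congr' ?_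
  filter_upwards [eventually_gt_atTop 0] with c hc0
  have hη : 0 < (c ^ 2)⁻¹ := by positivity
  set η := (c ^ 2)⁻¹
  have hd : ∀ z, 0 < Complex.normSq (z - a) + η := fun z =>
    add_pos_of_nonneg_of_pos (Complex.normSq_nonneg _) hη
  have hnC : ContDiff ℝ 1 fun z => Complex.normSq (z - a) + η :=
    (contDiff_normSq_sub a (n := 1)).add contDiff_const
  have hr : ContDiff ℝ 1 fun z => ((1 / (Complex.normSq (z - a) + η) : ℝ) : ℂ) :=
    Complex.ofRealCLM.contDiff.comp (contDiff_const.div hnC fun z => (hd z).ne')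
  have hcj : ContDiff ℝ 1 fun z : ℂ => conj (z - a) :=
    Complex.conjCLE.contDiff.comp (contDiff_id.sub contDiff_const)
  have hH : ContDiff ℝ 1 fun z => G z * (conj (z - a) *
      ((1 / (Complex.normSq (z - a) + η) : ℝ) : ℂ)) := hG.mul (hcj.mul hr)
  have h0 := integral_wirtingerZBar_eq_zero hH hc.mul_right
  have hder : ∀ z, wirtingerZBar (fun z => G z * (conj (z - a) *
      ((1 / (Complex.normSq (z - a) + η) : ℝ) : ℂ))) z =
      wirtingerZBar G z * (conj (z - a) * ((1 / (Complex.normSq (z - a) + η) : ℝ) : ℂ)) +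
        (η / (Complex.normSq (z - a) + η) ^ 2) • G z := by
    intro z
    have hω : HasDerivAt (fun t : ℝ => 1 / t) (-1 / (shiftedSq a η 1 z) ^ 2)
        (shiftedSq a η 1 z) := by
      have := hasDerivAt_inv (x := shiftedSq a η 1 z) (by simpa [shiftedSq] using (hd z).ne')
      refine (this.congr_deriv (by ring)).congr_of_eventuallyEq
        (Eventually.of_forall fun t => by simp)
    have hchain := wirtingerZBar_ofReal_comp hω
      ((contDiff_shiftedSq a η 1 (n := 1)).differentiable (by norm_num) z)
    rw [wirtingerZBar_shiftedSq] at hchain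
    simp only [shiftedSq, div_one] at hchain
    rw [wirtingerZBar_mul (hG.differentiable (by norm_num) z)
      ((hcj.mul hr).differentiable (by norm_num) z),
      wirtingerZBar_mul (hcj.differentiable (by norm_num) z) (hr.differentiable (by norm_num) z),
      wirtingerZBar_conj (by fun_prop), wirtingerZ_sub_const, hchain]
    have hdz : ((Complex.normSq (z - a) + η : ℝ) : ℂ) ≠ 0 := by
      exact_mod_cast (hd z).ne'
    have hzz : (z - a) * conj (z - a) = (Complex.normSq (z - a) + η : ℝ) - η := by
      rw [Complex.mul_conj]; push_cast; ring
    have hη' : (η : ℂ) = (Complex.normSq (z - a) + η : ℝ) - (z - a) * conj (z - a) := by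
      rw [hzz]; ring
    rw [Complex.real_smul]
    simp only [Complex.ofReal_div, Complex.ofReal_pow, Complex.ofReal_neg, Complex.ofReal_one,
      map_one]
    generalize ((Complex.normSq (z - a) + η : ℝ) : ℂ) = D at *
    rw [hη']
    field_simp
    ring
  simp only [hder] at h0
  rw [integral_add] at h0
  · rw [neg_eq_iff_add_eq_zero, add_comm]; exact h0
  · exact (hGb.mul (hcj.mul hr).continuous).integrable_of_hasCompactSupport hGbc.mul_right
  · exact ((continuous_const.div (hnC.continuous.pow 2) fun z => (pow_pos (hd z) 2).ne').smul
      hG.continuous).integrable_of_hasCompactSupport hc.smul_left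

/-! ### The Cauchy transform and Weyl's lemma -/

lemma locallyIntegrable_inv_mul (c : ℂ) : LocallyIntegrable (fun s : ℂ => (c * s)⁻¹) := by
  intro x
  refine ⟨Metric.ball 0 (‖x‖ + 1), Metric.isOpen_ball.mem_nhds (by simp), ?_⟩
  have h : IntegrableOn (fun s : ℂ => ‖c‖⁻¹ * ‖s‖⁻¹) (Metric.ball 0 (‖x‖ + 1)) := by
    rw [integrableOn_fun_norm_addHaar (volume : Measure ℂ) (f := fun t : ℝ => ‖c‖⁻¹ * t⁻¹),
      Complex.finrank_real_complex]
    have : IntegrableOn (fun _ : ℝ => ‖c‖⁻¹) (Set.Ioo 0 (‖x‖ + 1)) := by simp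
    refine this.congr_fun (fun t ht => ?_) measurableSet_Ioo
    have := ht.1.ne'
    simp; field_simp
  exact h.mono' (by fun_prop) (Eventually.of_forall fun s => by simp [mul_comm])

/-- The Cauchy transform `z ↦ ∫ η(z - s) / (π s)` of `η`. -/
noncomputable def cauchyTransform (η : ℂ → ℂ) : ℂ → ℂ :=
  convolution (fun s : ℂ => (Real.pi * s : ℂ)⁻¹) η (ContinuousLinearMap.mul ℝ ℂ) volume

lemma cauchyTransform_apply (η : ℂ → ℂ) (z : ℂ) :
    cauchyTransform η z = ∫ s, (Real.pi * (z - s) : ℂ)⁻¹ * η s := by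
  rw [cauchyTransform, convolution_def, ← integral_sub_left_eq_self _ volume z]
  simp

lemma contDiff_cauchyTransform {η : ℂ → ℂ} {n : ℕ∞} (hη : ContDiff ℝ n η)
    (hc : HasCompactSupport η) : ContDiff ℝ n (cauchyTransform η) :=
  hc.contDiff_convolution_right _ (locallyIntegrable_inv_mul _) hη

/-- The Cauchy transform solves the `∂̄`-equation. -/
lemma wirtingerZBar_cauchyTransform {η : ℂ → ℂ} (hη : ContDiff ℝ 1 η) (hc : HasCompactSupport η)
    (z : ℂ) : wirtingerZBar (cauchyTransform η) z = η z := by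
  have hf := fun v => DFunLike.congr_fun ((hc.hasFDerivAt_convolution_right
    (ContinuousLinearMap.mul ℝ ℂ) (locallyIntegrable_inv_mul Real.pi) hη z).fderiv) v
  have hv : ∀ v, fderiv ℝ (cauchyTransform η) z v =
      ∫ s, (Real.pi * s : ℂ)⁻¹ * fderiv ℝ η (z - s) v := fun v => by
    refine (hf v).trans ?_
    rw [convolution_precompR_apply _ (locallyIntegrable_inv_mul _) (hc.fderiv (𝕜 := ℝ))
      (hη.continuous_fderiv (by norm_num)), convolution_def]
    simp
  have hG : ContDiff ℝ 1 fun s => η (z - s) := hη.comp (contDiff_const.sub contDiff_id)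
  have hGc : HasCompactSupport fun s => η (z - s) :=
    hc.comp_homeomorph (Homeomorph.subLeft z)
  have hfd : ∀ s v, fderiv ℝ (fun s => η (z - s)) s v = -fderiv ℝ η (z - s) v := by
    intro s v
    have h1 : HasFDerivAt (fun s : ℂ => z - s) (-ContinuousLinearMap.id ℝ ℂ) s :=
      (hasFDerivAt_id s).const_sub z
    have h2 : HasFDerivAt (fun s => η (z - s)) _ s :=
      ((hη.differentiable (by norm_num)) (z - s)).hasFDerivAt.comp s h1
    rw [h2.fderiv]; simp
  have hi : ∀ v, Integrable fun s => (Real.pi * s : ℂ)⁻¹ * fderiv ℝ η (z - s) v := fun v => by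
    have h := (integrable_div_sub ((hG.continuous_fderiv (by norm_num)).clm_apply continuous_const)
      (hGc.fderiv_apply (𝕜 := ℝ) v) 0).const_mul (-(Real.pi : ℂ)⁻¹)
    refine h.congr (Eventually.of_forall fun s => ?_)
    simp only [hfd, sub_zero, mul_inv]; ring
  have hP := integral_wirtingerZBar_div_sub hG hGc 0
  rw [sub_zero] at hP
  have hπ : (Real.pi : ℂ) ≠ 0 := by exact_mod_cast Real.pi_ne_zero
  have : wirtingerZBar (cauchyTransform η) z =
      ∫ s, -(Real.pi : ℂ)⁻¹ * (wirtingerZBar (fun s => η (z - s)) s / (s - 0)) := by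
    rw [wirtingerZBar, hv, hv, ← integral_const_mul, ← integral_add (hi 1) ((hi _).const_mul _),
      ← integral_div]
    refine integral_congr_ae (Eventually.of_forall fun s => ?_)
    simp only [wirtingerZBar, hfd, sub_zero, mul_inv]; ring
  rw [this, integral_const_mul, hP]
  field_simp

lemma differentiableOn_integral_div_sub {H : ℂ → ℂ} (hH : Integrable H) {a : ℂ} {ρ ρ' : ℝ}
    (hρ : ρ < ρ') (h0 : ∀ ζ ∈ Metric.ball a ρ', H ζ = 0) :
    DifferentiableOn ℂ (fun z => ∫ ζ, H ζ * (Real.pi * (ζ - z) : ℂ)⁻¹) (Metric.ball a ρ) := by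
  intro z0 hz0
  have hd : 0 < ρ' - ρ := sub_pos.2 hρ
  have hfar : ∀ ζ, H ζ ≠ 0 → ∀ z ∈ Metric.ball a ρ, ρ' - ρ ≤ ‖ζ - z‖ := by
    intro ζ hζ z hz
    have h1 : ρ' ≤ dist ζ a := not_lt.1 fun h => hζ (h0 ζ h)
    have h2 : dist z a < ρ := hz
    have := dist_triangle ζ z a
    rw [dist_eq_norm ζ z] at this
    linarith
  have hπ : (Real.pi : ℂ) ≠ 0 := by exact_mod_cast Real.pi_ne_zero
  have key := hasDerivAt_integral_of_dominated_loc_of_deriv_le (𝕜 := ℂ) (μ := volume)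
    (F := fun z ζ => H ζ * (Real.pi * (ζ - z) : ℂ)⁻¹)
    (F' := fun z ζ => H ζ * (Real.pi * (ζ - z) ^ 2 : ℂ)⁻¹) (x₀ := z0)
    (s := Metric.ball a ρ) (bound := fun ζ => ‖H ζ‖ * (Real.pi * (ρ' - ρ) ^ 2)⁻¹)
    (Metric.isOpen_ball.mem_nhds hz0) (Eventually.of_forall fun z =>
      hH.aestronglyMeasurable.mul (by fun_prop)) ?_
      (hH.aestronglyMeasurable.mul (by fun_prop)) ?_ (hH.norm.mul_const _) ?_
  · exact key.2.differentiableAt.differentiableWithinAt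
  · refine (hH.norm.mul_const (Real.pi * (ρ' - ρ))⁻¹).mono'
      (hH.aestronglyMeasurable.mul (by fun_prop)) (Eventually.of_forall fun ζ => ?_)
    by_cases hζ : H ζ = 0
    · simp [hζ]
    have := hfar ζ hζ z0 hz0
    simp only [norm_mul, norm_inv, Complex.norm_real, Real.norm_eq_abs, abs_of_pos Real.pi_pos]
    gcongr
  · refine Eventually.of_forall fun ζ z hz => ?_
    by_cases hζ : H ζ = 0
    · simp [hζ]
    have := hfar ζ hζ z hz
    simp only [norm_mul, norm_inv, norm_pow, Complex.norm_real, Real.norm_eq_abs,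
      abs_of_pos Real.pi_pos]
    gcongr
  · refine Eventually.of_forall fun ζ z hz => ?_
    by_cases hζ : H ζ = 0
    · simpa [hζ] using hasDerivAt_const z (0 : ℂ)
    have hne : ζ - z ≠ 0 := norm_pos_iff.1 (hd.trans_le (hfar ζ hζ z hz))
    have h := ((((hasDerivAt_id z).const_sub ζ).const_mul (Real.pi : ℂ)).inv
      (mul_ne_zero hπ hne)).const_mul (H ζ)
    refine h.congr_deriv ?_
    simp only [id]
    field_simp

/-- Weyl's lemma for `∂̄`: an integrable weak solution of `∂̄F = 0` on a disc is almost everywhere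
equal to a holomorphic function on every smaller concentric disc. -/
theorem exists_holomorphic_ae_eq {F : ℂ → ℂ} (hF : Integrable F) {a : ℂ} {ρ R : ℝ} (hρ0 : 0 < ρ)
    (hρ : ρ < R)
    (hweak : ∀ B : ℂ → ℂ, ContDiff ℝ 2 B → HasCompactSupport B → tsupport B ⊆ Metric.ball a R →
      ∫ z, F z * wirtingerZBar B z = 0) :
    ∃ f : ℂ → ℂ, DifferentiableOn ℂ f (Metric.ball a ρ) ∧
      ∀ᵐ z, z ∈ Metric.ball a ρ → F z = f z := by
  let χ : ContDiffBump a := ⟨(ρ + R) / 2, (ρ + 3 * R) / 4, by linarith, by linarith⟩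
  let X : ℂ → ℂ := fun z => (χ z : ℂ)
  have hX : ContDiff ℝ 2 X := Complex.ofRealCLM.contDiff.comp χ.contDiff
  have hXsub : tsupport X ⊆ Metric.closedBall a ((ρ + 3 * R) / 4) := by
    rw [← show χ.rOut = (ρ + 3 * R) / 4 from rfl, ← χ.tsupport_eq]
    refine closure_mono fun z hz => ?_
    simpa [X] using hz
  have hX1 : ∀ z ∈ Metric.ball a ((ρ + R) / 2), X z = 1 := fun z hz => by
    simp [X, χ.one_of_mem_closedBall (Metric.ball_subset_closedBall hz)]
  have hXb0 : ∀ z ∈ Metric.ball a ((ρ + R) / 2), wirtingerZBar X z = 0 := fun z hz => by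
    rw [wirtingerZBar_congr (g := fun _ => 1)
      (Filter.mem_of_superset (Metric.isOpen_ball.mem_nhds hz) hX1)]
    simp [wirtingerZBar]
  have hXc : HasCompactSupport X := HasCompactSupport.of_support_subset_isCompact
    (isCompact_closedBall a ((ρ + 3 * R) / 4)) (subset_tsupport X |>.trans hXsub)
  have hXbc : Continuous (wirtingerZBar X) :=
    (hX.of_le (by norm_num : (1 : WithTop ℕ∞) ≤ 2)).continuous_wirtingerZBar
  obtain ⟨M, hM⟩ := hXbc.bounded_above_of_compact_support hXc.wirtingerZBar
  set H : ℂ → ℂ := fun ζ => F ζ * wirtingerZBar X ζ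
  have hH : Integrable H := hF.mul_bdd (c := M) hXbc.aestronglyMeasurable (Eventually.of_forall hM)
  have hH0 : ∀ ζ ∈ Metric.ball a ((ρ + R) / 2), H ζ = 0 := fun ζ hζ => by simp [H, hXb0 ζ hζ]
  have hdiff := (differentiableOn_integral_div_sub hH (a := a) (ρ := ρ) (by linarith) hH0).neg
  refine ⟨_, hdiff, ?_⟩
  set f : ℂ → ℂ := -fun z => ∫ ζ, H ζ * (Real.pi * (ζ - z) : ℂ)⁻¹ with hf
  have hae := Metric.isOpen_ball.ae_eq_zero_of_integral_contDiff_smul_eq_zero (μ := volume)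
    (f := fun z => F z - f z) (U := Metric.ball a ρ)
    ((hF.locallyIntegrable.locallyIntegrableOn _).sub
      (hdiff.continuousOn.locallyIntegrableOn Metric.isOpen_ball.measurableSet)) ?_
  · filter_upwards [hae] with z hz hzb
    exact sub_eq_zero.1 (hz hzb)
  intro g hg hgc hgs
  let η : ℂ → ℂ := fun z => (g z : ℂ)
  have hη : ContDiff ℝ 2 η := Complex.ofRealCLM.contDiff.comp (contDiff_infty.1 hg 2)
  have hηc : HasCompactSupport η := hgc.comp_left (g := fun t : ℝ => (t : ℂ)) (by simp)
  have hCη : ContDiff ℝ 2 (cauchyTransform η) := contDiff_cauchyTransform (n := 2) hη hηc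
  have h1le : (1 : WithTop ℕ∞) ≤ 2 := by norm_num
  have hg0 : ∀ z ∉ tsupport g, g z = 0 := fun z hz => image_eq_zero_of_notMem_tsupport hz
  obtain ⟨M', hM'⟩ := hη.continuous.bounded_above_of_compact_support hηc
  have iF : Integrable fun z => F z * η z :=
    hF.mul_bdd (c := M') hη.continuous.aestronglyMeasurable (Eventually.of_forall hM')
  have iHC : Integrable fun ζ => H ζ * cauchyTransform η ζ := by
    obtain ⟨M'', hM''⟩ := (hXbc.mul hCη.continuous).bounded_above_of_compact_support
      (hXc.wirtingerZBar.mul_right)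
    refine (hF.mul_bdd (c := M'') (hXbc.mul hCη.continuous).aestronglyMeasurable
      (Eventually.of_forall hM'')).congr (Eventually.of_forall fun z => ?_)
    exact (mul_assoc _ _ _).symm
  -- the weak equation, tested against a cut-off of the Cauchy transform of `g`
  have e1 : ∫ z, F z * η z = -∫ ζ, H ζ * cauchyTransform η ζ := by
    have h := hweak (fun z => X z * cauchyTransform η z) (hX.mul hCη) hXc.mul_right
      ((tsupport_mul_subset_left).trans (hXsub.trans (Metric.closedBall_subset_ball (by linarith))))
    have hb : ∀ z, F z * wirtingerZBar (fun z => X z * cauchyTransform η z) z =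
        H z * cauchyTransform η z + F z * η z := by
      intro z
      rw [wirtingerZBar_mul (hX.differentiable (by norm_num) z)
        (hCη.differentiable (by norm_num) z), wirtingerZBar_cauchyTransform (hη.of_le h1le) hηc]
      by_cases hz : z ∈ tsupport g
      · rw [hX1 z (Metric.ball_subset_ball (by linarith) (hgs hz))]; simp only [H]; ring
      · have : η z = 0 := by simp [η, hg0 z hz]
        rw [this]; simp only [H]; ring
    simp only [hb] at h
    rw [integral_add iHC iF] at h
    linear_combination h
  have hIP : Integrable (Function.uncurry fun z ζ => η z * (H ζ * (Real.pi * (ζ - z) : ℂ)⁻¹))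
      (volume.prod volume) := by
    have hηi : Integrable η := hη.continuous.integrable_of_hasCompactSupport hηc
    refine ((hηi.norm.mul_prod hH.norm).mul_const (Real.pi * ((R - ρ) / 2))⁻¹).mono' ?_
      (Eventually.of_forall fun p => ?_)
    · refine (hη.continuous.comp continuous_fst).aestronglyMeasurable.mul
        ((hH.aestronglyMeasurable.comp_snd).mul ?_)
      fun_prop
    · obtain ⟨z, ζ⟩ := p
      simp only [Function.uncurry]
      by_cases hζ : ζ ∈ Metric.ball a ((ρ + R) / 2)
      · simp [hH0 ζ hζ]
      by_cases hz : z ∈ tsupport g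
      · have h1 : (ρ + R) / 2 ≤ dist ζ a := not_lt.1 hζ
        have h2 : dist z a < ρ := hgs hz
        have h3 := dist_triangle ζ z a
        rw [dist_eq_norm ζ z] at h3
        have h4 : (R - ρ) / 2 ≤ ‖ζ - z‖ := by linarith
        simp only [norm_mul, norm_inv, Complex.norm_real, Real.norm_eq_abs, abs_of_pos Real.pi_pos]
        rw [← mul_assoc]
        have : 0 < (R - ρ) / 2 := by linarith
        gcongr
      · simp [η, hg0 z hz]
  have e2 : ∫ z, η z * f z = -∫ ζ, H ζ * cauchyTransform η ζ := by
    have : ∀ z, η z * f z = -∫ ζ, η z * (H ζ * (Real.pi * (ζ - z) : ℂ)⁻¹) := fun z => by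
      rw [integral_const_mul]; simp [hf]
    simp only [this]
    rw [integral_neg, integral_integral_swap hIP]
    congr 1
    refine integral_congr_ae (Eventually.of_forall fun ζ => ?_)
    simp only []
    rw [cauchyTransform_apply, ← integral_const_mul]
    refine integral_congr_ae (Eventually.of_forall fun z => ?_)
    simp only []; ring
  have if' : Integrable fun z => η z * f z := by
    refine integrable_of_continuousOn_of_forall_notMem hgc (hη.continuous.continuousOn.mul
      (hdiff.continuousOn.mono hgs)) fun z hz => by simp [η, hg0 z hz]
  have : ∀ z, g z • (F z - f z) = F z * η z - η z * f z := fun z => by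
    rw [Complex.real_smul]; simp only [η]; ring
  simp only [this]
  rw [integral_sub iF if', e1, e2, sub_self]

/-! ### The sharp extension theorem -/

/-- The functions `e^{Φ/2} ∂B/∂z̄`, for `B` a `C²` test function on `Δ(a; R)`, as a subspace of
`L²(Δ(a; R))`. -/
noncomputable def dbarTestSubmodule (a : ℂ) (R : ℝ) (Φ : ℂ → ℝ) :
    Submodule ℂ (Lp ℂ 2 (volume.restrict (Metric.ball a R))) where
  carrier := {u | ∃ B : ℂ → ℂ, ContDiff ℝ 2 B ∧ HasCompactSupport B ∧
    tsupport B ⊆ Metric.ball a R ∧ u =ᵐ[volume.restrict (Metric.ball a R)]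
      fun z => (Real.exp (Φ z / 2) : ℂ) * wirtingerZBar B z}
  add_mem' := by
    rintro u v ⟨B, hB, hBc, hBs, hu⟩ ⟨C, hC, hCc, hCs, hv⟩
    refine ⟨fun z => B z + C z, hB.add hC, hBc.add hCc,
      (tsupport_add B C).trans (Set.union_subset hBs hCs), ?_⟩
    filter_upwards [hu, hv, Lp.coeFn_add u v] with z h1 h2 h3
    rw [h3, Pi.add_apply, h1, h2, wirtingerZBar_add (hB.differentiable (by norm_num) z)
      (hC.differentiable (by norm_num) z)]
    ring
  zero_mem' := by
    refine ⟨fun _ => 0, contDiff_const, HasCompactSupport.zero, ?_, ?_⟩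
    · simp [tsupport]
    · filter_upwards [Lp.coeFn_zero ℂ 2 (volume.restrict (Metric.ball a R))] with z h
      rw [h]; simp [wirtingerZBar]
  smul_mem' := by
    rintro c u ⟨B, hB, hBc, hBs, hu⟩
    refine ⟨fun z => c * B z, contDiff_const.mul hB, hBc.mul_left,
      tsupport_mul_subset_right.trans hBs, ?_⟩
    filter_upwards [hu, Lp.coeFn_smul c u] with z h1 h2
    rw [h2, Pi.smul_apply, h1, wirtingerZBar_mul (differentiableAt_const c)
      (hB.differentiable (by norm_num) z), wirtingerZBar_eq_zero (differentiableAt_const c)]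
    simp only [smul_eq_mul]; ring

lemma L2_norm_sq_eq {μ : Measure ℂ} (u : Lp ℂ 2 μ) : ‖u‖ ^ 2 = ∫ z, ‖u z‖ ^ 2 ∂μ := by
  have h := L2.inner_def (𝕜 := ℂ) u u
  rw [inner_self_eq_norm_sq_to_K] at h
  simp only [inner_self_eq_norm_sq_to_K] at h
  have h2 : ∫ z, ((‖u z‖ : ℂ)) ^ 2 ∂μ = ((∫ z, ‖u z‖ ^ 2 ∂μ : ℝ) : ℂ) := by
    rw [← integral_complex_ofReal]; simp
  exact Complex.ofReal_injective ((Complex.ofReal_pow _ _).trans (h.trans h2))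

/-- The sharp Ohsawa–Takegoshi theorem on a disc, from its centre, with a `C²` subharmonic weight;
the norm is controlled on a slightly smaller disc. -/
theorem exists_sharp_extension {a : ℂ} {r R : ℝ} (hr : 0 < r) (hrR : r < R) {Φ : ℂ → ℝ}
    (hΦ : ∀ z ∈ Metric.closedBall a R, ContDiffAt ℝ 2 Φ z)
    (hsub : ∀ z ∈ Metric.closedBall a R, 0 ≤ ddbarCoeff Φ z) :
    ∃ f : ℂ → ℂ, DifferentiableOn ℂ f (Metric.ball a r) ∧ f a = 1 ∧
      weightedNormSq (Metric.ball a r) Φ f ≤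
        ENNReal.ofReal (Real.pi * R ^ 2 * Real.exp (-Φ a)) := by
  have hR : 0 < R := hr.trans hrR
  have h1le : (1 : WithTop ℕ∞) ≤ 2 := by norm_num
  set μ := (volume : Measure ℂ).restrict (Metric.ball a R) with hμ
  have hfin : IsFiniteMeasure μ :=
    ⟨by rw [hμ, Measure.restrict_apply_univ]; exact measure_ball_lt_top⟩
  have hΦc : ContinuousOn Φ (Metric.closedBall a R) := fun z hz =>
    (hΦ z hz).continuousAt.continuousWithinAt
  have hball : Metric.ball a R ⊆ Metric.closedBall a R := Metric.ball_subset_closedBall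
  -- the cut-off `χ` and the kernel `k = χ_z̄ / (z - a)`
  let χb : ContDiffBump a := ⟨r / 3, r / 2, by linarith, by linarith⟩
  let χ : ℂ → ℂ := fun z => (χb z : ℂ)
  have hχ : ContDiff ℝ 2 χ := Complex.ofRealCLM.contDiff.comp χb.contDiff
  have hχsub : tsupport χ ⊆ Metric.closedBall a (r / 2) := by
    rw [← show χb.rOut = r / 2 from rfl, ← χb.tsupport_eq]
    refine closure_mono fun z hz => ?_
    simpa [χ] using hz
  have hχr : tsupport χ ⊆ Metric.ball a r :=
    hχsub.trans (Metric.closedBall_subset_ball (by linarith))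
  have hrRb : Metric.ball a r ⊆ Metric.ball a R := Metric.ball_subset_ball hrR.le
  have hχc : HasCompactSupport χ := HasCompactSupport.of_support_subset_isCompact
    (isCompact_closedBall a (r / 2)) (subset_tsupport χ |>.trans hχsub)
  have hχ1 : ∀ z ∈ Metric.ball a (r / 3), χ z = 1 := fun z hz => by
    simp [χ, χb.one_of_mem_closedBall (Metric.ball_subset_closedBall hz)]
  have hχb0 : ∀ z ∈ Metric.ball a (r / 3), wirtingerZBar χ z = 0 := fun z hz => by
    rw [wirtingerZBar_congr (g := fun _ => 1)
      (Filter.mem_of_superset (Metric.isOpen_ball.mem_nhds hz) hχ1)]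
    simp [wirtingerZBar]
  have ha3 : a ∈ Metric.ball a (r / 3) := Metric.mem_ball_self (by linarith)
  set k : ℂ → ℂ := fun z => wirtingerZBar χ z / (z - a) with hk
  have hkc : Continuous k := continuous_iff_continuousAt.2 fun z => by
    by_cases hz : z = a
    · subst hz
      exact continuousAt_const.congr (f := fun _ => (0 : ℂ)) (Filter.mem_of_superset
        (Metric.isOpen_ball.mem_nhds ha3) fun w hw => by simp [hk, hχb0 w hw])
    · exact (hχ.of_le h1le).continuous_wirtingerZBar.continuousAt.div (by fun_prop)
        (sub_ne_zero.2 hz)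
  have hks : tsupport k ⊆ tsupport χ := by
    refine closure_minimal (fun z hz => ?_) (isClosed_tsupport χ)
    by_contra h
    refine hz ?_
    simp [hk, image_eq_zero_of_notMem_tsupport fun h' => h (tsupport_wirtingerZBar_subset χ h')]
  have hksupp : HasCompactSupport k := hχc.mono' (subset_tsupport k |>.trans hks)
  have hkχ : ∀ z, (z - a) * k z = wirtingerZBar χ z := fun z => by
    by_cases hz : z = a
    · subst hz; simp [hχb0 z ha3]
    · have := sub_ne_zero.2 hz
      simp only [hk]; field_simp
  -- multiplication by `e^{Φ/2}` of continuous functions supported in the disc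
  have hL2 : ∀ h : ℂ → ℂ, Continuous h →
      MemLp (fun z => (Real.exp (Φ z / 2) : ℂ) * h z) 2 μ := by
    intro h hh
    have hc : ContinuousOn (fun z => (Real.exp (Φ z / 2) : ℂ) * h z) (Metric.closedBall a R) := by
      refine ContinuousOn.mul ?_ hh.continuousOn
      exact Complex.continuous_ofReal.comp_continuousOn (hΦc.div_const 2).rexp
    obtain ⟨C, hC⟩ := (isCompact_closedBall a R).exists_bound_of_continuousOn hc
    refine MemLp.of_bound ((hc.mono hball).aestronglyMeasurable measurableSet_ball) C ?_
    exact (ae_restrict_iff' measurableSet_ball).2 (Eventually.of_forall fun z hz => hC z (hball hz))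
  set e : Lp ℂ 2 μ := (hL2 k hkc).toLp _ with he
  have hecoe : e =ᵐ[μ] fun z => (Real.exp (Φ z / 2) : ℂ) * k z := (hL2 k hkc).coeFn_toLp
  set S := dbarTestSubmodule a R Φ
  have hdist : ∀ s ∈ S, Real.pi * Real.exp (Φ a) / R ^ 2 ≤ ‖e - s‖ ^ 2 := by
    rintro s ⟨B, hB, hBc, hBs, hs⟩
    have hBb := (hB.of_le h1le).continuous_wirtingerZBar
    have hid : ContDiff ℝ 2 fun z : ℂ => z - a := contDiff_id.sub contDiff_const
    set k' : ℂ → ℂ := fun z => k z + (-1) * wirtingerZBar B z with hk'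
    have hk's : tsupport k' ⊆ Metric.ball a R :=
      (tsupport_add _ _).trans (Set.union_subset (hks.trans (hχr.trans hrRb))
        (tsupport_mul_subset_right.trans ((tsupport_wirtingerZBar_subset B).trans hBs)))
    have hE := sharp_basic_estimate (a := a) hR (Φ := Φ)
      (A := fun z => χ z + (-1) * ((z - a) * B z)) (k := k')
      (fun z hz => hΦ z (hball hz)) (fun z hz => hsub z (hball hz))
      (hχ.add (contDiff_const.mul (hid.mul hB))) (hχc.add hBc.mul_left.mul_left)
      ((tsupport_add _ _).trans (Set.union_subset (hχr.trans hrRb)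
        (tsupport_mul_subset_right.trans (tsupport_mul_subset_right.trans hBs))))
      (hkc.add (continuous_const.mul hBb)) (hksupp.add hBc.wirtingerZBar.mul_left) hk's
      (fun z => by
        have hBd := hB.differentiable (by norm_num) z
        have hidd := hid.differentiable (by norm_num) z
        rw [wirtingerZBar_add (hχ.differentiable (by norm_num) z)
          ((differentiableAt_const _).fun_mul (hidd.fun_mul hBd)),
          wirtingerZBar_mul (differentiableAt_const _) (hidd.fun_mul hBd),
          wirtingerZBar_mul hidd hBd, wirtingerZBar_sub_const,
          wirtingerZBar_eq_zero (differentiableAt_const _), ← hkχ]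
        simp only [hk']; ring)
    have hA1 : χ a + (-1) * ((a - a) * B a) = 1 := by simp [hχ1 a ha3]
    rw [hA1, norm_one, one_pow, mul_one] at hE
    have hn : ‖e - s‖ ^ 2 = ∫ z, Real.exp (Φ z) * ‖k' z‖ ^ 2 := by
      rw [L2_norm_sq_eq, ← setIntegral_eq_integral_of_forall_compl_eq_zero (s := Metric.ball a R)
        (f := fun z => Real.exp (Φ z) * ‖k' z‖ ^ 2)]
      · refine integral_congr_ae ?_
        filter_upwards [hecoe, hs, Lp.coeFn_sub e s] with z h1 h2 h3
        rw [h3, Pi.sub_apply, h1, h2, ← mul_sub, norm_mul, mul_pow, Complex.norm_real,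
          Real.norm_eq_abs, Real.abs_exp, ← Real.exp_nat_mul]
        simp only [hk']
        congr 2
        · push_cast; ring
        · congr 1; ring
      · intro z hz
        rw [image_eq_zero_of_notMem_tsupport fun h => hz (hk's h)]; simp
    rw [hn, div_le_iff₀ (by positivity)]
    linarith
  -- split off the component of `e` orthogonal to the range of `∂̄`
  obtain ⟨y, hy, v, hv, hev⟩ := S.topologicalClosure.exists_add_mem_mem_orthogonal e
  have hvn : Real.pi * Real.exp (Φ a) / R ^ 2 ≤ ‖v‖ ^ 2 := by
    have hvy : v = e - y := by rw [hev]; abel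
    have hcl : IsClosed {s : Lp ℂ 2 μ | Real.pi * Real.exp (Φ a) / R ^ 2 ≤ ‖e - s‖ ^ 2} :=
      isClosed_le continuous_const (by fun_prop)
    rw [hvy]
    exact closure_minimal hdist hcl hy
  have hd0 : 0 < ‖v‖ ^ 2 := lt_of_lt_of_le (by positivity) hvn
  have hvS : ∀ s ∈ S, inner ℂ v s = 0 := fun s hs =>
    Submodule.inner_left_of_mem_orthogonal (S.le_topologicalClosure hs) hv
  have hve : inner ℂ v e = (‖v‖ : ℂ) ^ 2 := by
    rw [hev, inner_add_right, Submodule.inner_left_of_mem_orthogonal hy hv, zero_add,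
      inner_self_eq_norm_sq_to_K]; rfl
  have hvL1 : Integrable v μ := (Lp.memLp v).integrable (by norm_num)
  set F : ℂ → ℂ := (Metric.ball a R).indicator fun z => conj (v z) * (Real.exp (Φ z / 2) : ℂ)
    with hFdef
  have hexpc : ContinuousOn (fun z => (Real.exp (Φ z / 2) : ℂ)) (Metric.closedBall a R) :=
    Complex.continuous_ofReal.comp_continuousOn (hΦc.div_const 2).rexp
  have hF : Integrable F := by
    rw [hFdef, integrable_indicator_iff measurableSet_ball]
    obtain ⟨C, hC⟩ := (isCompact_closedBall a R).exists_bound_of_continuousOn hexpc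
    have hvc : Integrable (fun z => conj (v z)) μ :=
      hvL1.congr' (Complex.continuous_conj.comp_aestronglyMeasurable hvL1.1)
        (Eventually.of_forall fun z => by simp)
    exact hvc.mul_bdd (c := C) ((hexpc.mono hball).aestronglyMeasurable measurableSet_ball)
      ((ae_restrict_iff' measurableSet_ball).2 (Eventually.of_forall fun z hz => hC z (hball hz)))
  have hFint : ∀ (h : ℂ → ℂ) (u : Lp ℂ 2 μ),
      u =ᵐ[μ] (fun z => (Real.exp (Φ z / 2) : ℂ) * h z) → ∫ z, F z * h z = inner ℂ v u := by
    intro h u hu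
    have : (fun z => F z * h z) = (Metric.ball a R).indicator fun z =>
        conj (v z) * (Real.exp (Φ z / 2) : ℂ) * h z := by
      ext z; by_cases hz : z ∈ Metric.ball a R <;> simp [hFdef, hz]
    rw [this, integral_indicator measurableSet_ball, L2.inner_def]
    refine integral_congr_ae ?_
    filter_upwards [hu] with z hz
    rw [hz]; simp [inner]; ring
  obtain ⟨f, hf, hfF⟩ := exists_holomorphic_ae_eq hF hr hrR fun B hB hBc hBs => by
    have hm := hL2 (wirtingerZBar B) (hB.of_le h1le).continuous_wirtingerZBar
    rw [hFint _ (hm.toLp _) hm.coeFn_toLp]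
    exact hvS _ ⟨B, hB, hBc, hBs, hm.coeFn_toLp⟩
  -- the value of `f` at the centre, by the Cauchy–Pompeiu formula for `f χ`
  have hfa : -(Real.pi * f a : ℂ) = (‖v‖ : ℂ) ^ 2 := by
    rw [← hve, ← hFint k e hecoe]
    have hfd : ∀ z ∈ tsupport χ, DifferentiableAt ℂ f z := fun z hz =>
      hf.differentiableAt (Metric.isOpen_ball.mem_nhds (hχr hz))
    have hfC : ∀ z ∈ tsupport χ, ContDiffAt ℝ 1 f z := fun z hz =>
      ((hf.contDiffOn (n := 1) Metric.isOpen_ball).contDiffAt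
        (Metric.isOpen_ball.mem_nhds (hχr hz))).restrict_scalars ℝ
    have hG : ContDiff ℝ 1 fun z => f z * χ z :=
      contDiff_of_forall_mem_isClosed (n := 1) (isClosed_tsupport χ)
        (fun z hz => (hfC z hz).mul (hχ.of_le h1le).contDiffAt)
        fun z hz => by simp [image_eq_zero_of_notMem_tsupport hz]
    have h := integral_wirtingerZBar_div_sub hG hχc.mul_left a
    rw [hχ1 a ha3, mul_one] at h
    rw [← h]
    refine integral_congr_ae ?_
    filter_upwards [hfF] with z hz
    by_cases hzs : z ∈ tsupport χ
    · rw [hz (hχr hzs), wirtingerZBar_mul ((hfC z hzs).differentiableAt (by norm_num))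
        (hχ.differentiable (by norm_num) z), wirtingerZBar_eq_zero (hfd z hzs)]
      simp only [hk]; ring
    · have h1 : k z = 0 := image_eq_zero_of_notMem_tsupport fun h => hzs (hks h)
      have h2 : wirtingerZBar (fun z => f z * χ z) z = 0 :=
        image_eq_zero_of_notMem_tsupport fun h =>
          hzs (tsupport_mul_subset_right (tsupport_wirtingerZBar_subset _ h))
      rw [h1, h2]; simp
  have hfa' : f a = -((‖v‖ ^ 2 / Real.pi : ℝ) : ℂ) := by
    have hπ : (Real.pi : ℂ) ≠ 0 := by exact_mod_cast Real.pi_ne_zero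
    push_cast
    rw [← hfa]; field_simp
  have hfn : ‖f a‖ = ‖v‖ ^ 2 / Real.pi := by
    rw [hfa', norm_neg, Complex.norm_real, Real.norm_eq_abs, abs_of_nonneg (by positivity)]
  have hf0 : f a ≠ 0 := norm_pos_iff.1 (by rw [hfn]; positivity)
  have hnorm : weightedNormSq (Metric.ball a r) Φ f ≤ ENNReal.ofReal (‖v‖ ^ 2) := by
    have hvi : Integrable (fun z => ‖v z‖ ^ 2) μ := (Lp.memLp v).integrable_norm_pow (by norm_num)
    rw [L2_norm_sq_eq, ofReal_integral_eq_lintegral_ofReal hvi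
      (Eventually.of_forall fun z => by positivity)]
    calc weightedNormSq (Metric.ball a r) Φ f
        = ∫⁻ z in Metric.ball a r, ENNReal.ofReal (‖v z‖ ^ 2) := by
          refine setLIntegral_congr_fun_ae measurableSet_ball ?_
          filter_upwards [hfF] with z hz hzr
          rw [← hz hzr, hFdef, Set.indicator_of_mem (hrRb hzr), norm_mul, mul_pow,
            Complex.norm_conj, Complex.norm_real, Real.norm_eq_abs, Real.abs_exp,
            ← Real.exp_nat_mul, mul_assoc, ← Real.exp_add]
          congr 1
          have : ((2 : ℕ) : ℝ) * (Φ z / 2) + -Φ z = 0 := by push_cast; ring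
          rw [this]; simp
      _ ≤ _ := lintegral_mono_set hrRb
  refine ⟨fun z => (f a)⁻¹ * f z, hf.const_mul _, inv_mul_cancel₀ hf0, ?_⟩
  rw [weightedNormSq_smul]
  calc _ ≤ ENNReal.ofReal (‖(f a)⁻¹‖ ^ 2) * ENNReal.ofReal (‖v‖ ^ 2) := by gcongr
    _ = ENNReal.ofReal (Real.pi ^ 2 / ‖v‖ ^ 2) := by
      rw [← ENNReal.ofReal_mul (by positivity), norm_inv, hfn]
      congr 1
      have : ‖v‖ ≠ 0 := fun h => by simp [h] at hd0
      field_simp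
    _ ≤ _ := by
      refine ENNReal.ofReal_le_ofReal ?_
      rw [Real.exp_neg, div_le_iff₀ hd0]
      rw [div_le_iff₀ (by positivity)] at hvn
      have := mul_le_mul_of_nonneg_left hvn (show 0 ≤ Real.pi * (Real.exp (Φ a))⁻¹ by positivity)
      have e1 : Real.pi * (Real.exp (Φ a))⁻¹ * (Real.pi * Real.exp (Φ a)) = Real.pi ^ 2 := by
        field_simp
      linarith

/-! ### Second-order expansion of the weight -/

lemma fderiv_ofReal_apply {u : ℂ → ℝ} {z : ℂ} (hu : DifferentiableAt ℝ u z) (v : ℂ) :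
    fderiv ℝ (fun z => (u z : ℂ)) z v = (fderiv ℝ u z v : ℂ) := by
  have h : HasFDerivAt (fun z => (u z : ℂ)) (Complex.ofRealCLM.comp (fderiv ℝ u z)) z :=
    (Complex.ofRealCLM.hasFDerivAt).comp z hu.hasFDerivAt
  rw [h.fderiv]; simp

lemma ddbarCoeff_eq {Φ : ℂ → ℝ} {a : ℂ} (hΦ : ContDiffAt ℝ 2 Φ a) :
    ddbarCoeff Φ a = (fderiv ℝ (fderiv ℝ Φ) a 1 1 +
      fderiv ℝ (fderiv ℝ Φ) a Complex.I Complex.I) / 4 := by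
  have hc : ContDiffAt ℝ 2 (fun z => (Φ z : ℂ)) a := contDiffAt_ofReal_comp (n := 2) hΦ
  have hev : ∀ᶠ z in 𝓝 a, DifferentiableAt ℝ Φ z :=
    (hΦ.eventually (by simp)).mono fun z hz => hz.differentiableAt (by norm_num)
  have hd : DifferentiableAt ℝ (fderiv ℝ Φ) a :=
    (hΦ.fderiv_right (m := 1) (by norm_num)).differentiableAt (by norm_num)
  have h2 : ∀ v w, fderiv ℝ (fderiv ℝ fun z => (Φ z : ℂ)) a v w
      = (fderiv ℝ (fderiv ℝ Φ) a v w : ℂ) := by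
    intro v w
    rw [← fderiv_fderiv_apply hc]
    have e : (fun z => fderiv ℝ (fun z => (Φ z : ℂ)) z w) =ᶠ[𝓝 a]
        fun z => ((fderiv ℝ Φ z w : ℝ) : ℂ) := hev.mono fun z hz => fderiv_ofReal_apply hz w
    rw [e.fderiv_eq, fderiv_ofReal_apply (hd.clm_apply (differentiableAt_const w)),
      fderiv_clm_apply hd (differentiableAt_const w)]
    simp
  rw [ddbarCoeff, wirtingerZ_wirtingerZBar hc, h2, h2]
  norm_cast

/-- The second-order Taylor expansion of a `C²` weight: up to `o(|h|²)`, `Φ(a + h)` is a constant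
plus the real part of a holomorphic polynomial plus `∂²Φ/∂z∂z̄(a) |h|²`. -/
lemma exists_taylor_two {Φ : ℂ → ℝ} {a : ℂ} (hΦ : ContDiffAt ℝ 2 Φ a) :
    ∃ p q : ℂ, ∀ η : ℝ, 0 < η → ∃ ρ : ℝ, 0 < ρ ∧ ∀ h : ℂ, ‖h‖ < ρ →
      |Φ (a + h) - Φ a - (p * h + q * h ^ 2).re - ddbarCoeff Φ a * ‖h‖ ^ 2| ≤ η * ‖h‖ ^ 2 := by
  set L := fderiv ℝ Φ a
  set Q := fderiv ℝ (fderiv ℝ Φ) a with hQ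
  have hsymm : ∀ v w, Q v w = Q w v := fun v w => (hΦ.isSymmSndFDerivAt (by simp)).eq v w
  refine ⟨L 1 - Complex.I * L Complex.I, (Q 1 1 - Q Complex.I Complex.I) / 4 -
    Complex.I * Q 1 Complex.I / 2, fun η hη => ?_⟩
  have hd : HasFDerivAt (fderiv ℝ Φ) Q a :=
    ((hΦ.fderiv_right (m := 1) (by norm_num)).differentiableAt (by norm_num)).hasFDerivAt
  have hev : ∀ᶠ z in 𝓝 a, DifferentiableAt ℝ Φ z :=
    (hΦ.eventually (by simp)).mono fun z hz => hz.differentiableAt (by norm_num)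
  have ho := (hasFDerivAt_iff_isLittleO_nhds_zero.1 hd).def hη
  have hev0 : ∀ᶠ h in 𝓝 (0 : ℂ), DifferentiableAt ℝ Φ (a + h) := by
    have : Tendsto (fun h : ℂ => a + h) (𝓝 0) (𝓝 a) := by
      simpa using (continuous_const_add a).tendsto (0 : ℂ)
    exact this.eventually hev
  obtain ⟨ρ, hρ, hball⟩ := Metric.eventually_nhds_iff_ball.1 (ho.and hev0)
  refine ⟨ρ, hρ, fun h hh => ?_⟩
  set R : ℂ → ℝ := fun h => Φ (a + h) - Φ a - L h - (1 / 2) * Q h h with hR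
  have hder : ∀ x ∈ Metric.closedBall (0 : ℂ) ‖h‖,
      HasFDerivWithinAt R (fderiv ℝ Φ (a + x) - L - Q x) (Metric.closedBall 0 ‖h‖) x := by
    intro x hx
    have hxρ : x ∈ Metric.ball (0 : ℂ) ρ := by
      simp only [Metric.mem_closedBall, Metric.mem_ball, dist_zero_right] at hx ⊢; linarith
    have h1 : HasFDerivAt (fun x => Φ (a + x)) (fderiv ℝ Φ (a + x)) x := by
      have := (hball x hxρ).2.hasFDerivAt.comp x ((hasFDerivAt_id x).const_add a)
      exact this
    have h2 : HasFDerivAt (fun x => Q x x) (Q x + Q.flip x) x := by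
      have := Q.hasFDerivAt.clm_apply (hasFDerivAt_id x)
      refine this.congr_fderiv ?_
      ext v
      simp
    have h3 := ((h1.sub_const (Φ a)).sub L.hasFDerivAt).sub (h2.const_mul (1 / 2))
    refine (h3.congr_fderiv ?_).hasFDerivWithinAt
    have : Q.flip x = Q x := by
      ext
      exact hsymm _ _
    rw [this]
    ext
    simp
    ring
  have hb : ∀ x ∈ Metric.closedBall (0 : ℂ) ‖h‖, ‖fderiv ℝ Φ (a + x) - L - Q x‖ ≤ η * ‖h‖ := by
    intro x hx
    simp only [Metric.mem_closedBall, dist_zero_right] at hx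
    have := (hball x (by simp only [Metric.mem_ball, dist_zero_right]; linarith)).1
    exact this.trans (mul_le_mul_of_nonneg_left hx hη.le)
  have hfin := Convex.norm_image_sub_le_of_norm_hasFDerivWithin_le hder hb
    (convex_closedBall _ _) (x := 0) (y := h) (by simp) (by simp)
  have hR0 : R 0 = 0 := by simp [hR]
  rw [hR0, sub_zero, sub_zero, Real.norm_eq_abs, mul_assoc, ← pow_two] at hfin
  convert hfin using 2
  have hh' : h = h.re • (1 : ℂ) + h.im • Complex.I := by
    simp [Complex.re_add_im]
  have hL : L h = h.re * L 1 + h.im * L Complex.I := by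
    conv_lhs => rw [hh']
    rw [map_add, map_smul, map_smul, smul_eq_mul, smul_eq_mul]
  have hQh : Q h h = h.re ^ 2 * Q 1 1 + 2 * h.re * h.im * Q 1 Complex.I +
      h.im ^ 2 * Q Complex.I Complex.I := by
    conv_lhs => rw [hh']
    simp only [map_add, map_smul, add_apply, smul_apply, smul_eq_mul, hsymm Complex.I 1]
    ring
  rw [ddbarCoeff_eq hΦ, ← hQ, hR]
  simp only
  rw [hL, hQh, ← Complex.normSq_eq_norm_sq, Complex.normSq_apply]
  simp [pow_two]
  ring

/-! ### Radial integrals and the mean value property -/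

lemma integral_ball_norm_pow (a : ℂ) {r : ℝ} (hr : 0 < r) (m : ℕ) :
    ∫ z in Metric.ball a r, ‖z - a‖ ^ (2 * m) = Real.pi * r ^ (2 * m + 2) / (m + 1) := by
  have e : (Metric.ball a r).indicator (fun z => ‖z - a‖ ^ (2 * m)) =
      fun z => (Set.Iio r).indicator (fun t : ℝ => t ^ (2 * m)) ‖z - a‖ := by
    ext z
    by_cases hz : ‖z - a‖ < r <;> simp [Set.indicator, dist_eq_norm, hz]
  rw [← integral_indicator measurableSet_ball, e,
    integral_sub_right_eq_self
      (fun z : ℂ => (Set.Iio r).indicator (fun t : ℝ => t ^ (2 * m)) ‖z‖) a,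
    integral_fun_norm_addHaar (volume : Measure ℂ), volume_real_ball_complex zero_le_one,
    Complex.finrank_real_complex]
  have e2 : ∀ t : ℝ, t ^ (2 - 1) • (Set.Iio r).indicator (fun t : ℝ => t ^ (2 * m)) t =
      (Set.Iio r).indicator (fun t : ℝ => t ^ (2 * m + 1)) t := fun t => by
    by_cases ht : t < r <;> simp [Set.indicator, ht, pow_succ']
  simp only [e2]
  rw [setIntegral_indicator measurableSet_Iio, Set.Ioi_inter_Iio, ← integral_Ioc_eq_integral_Ioo,
    ← intervalIntegral.integral_of_le hr.le, integral_pow]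
  simp only [smul_eq_mul, nsmul_eq_mul]
  push_cast
  field_simp
  ring

/-- The mean value property against a radial density. -/
lemma integral_ball_mul_radial {g : ℂ → ℂ} {a : ℂ} {r r' : ℝ} (hr' : r' < r)
    (hg : DifferentiableOn ℂ g (Metric.ball a r)) {k : ℝ → ℝ} (hk : Continuous k) :
    ∫ z in Metric.ball a r', g z * (k ‖z - a‖ : ℂ) =
      g a * ((∫ z in Metric.ball a r', k ‖z - a‖ : ℝ) : ℂ) := by
  have hshift : ∀ G : ℂ → ℂ, ∫ z in Metric.ball a r', G z =
      ∫ h in Metric.ball (0 : ℂ) r', G (a + h) := fun G => by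
    have := (measurePreserving_add_left (volume : Measure ℂ) a).setIntegral_preimage_emb
      (measurableEmbedding_addLeft a) G (Metric.ball a r')
    rw [← this]
    congr 2
    ext; simp [dist_eq_norm]
  have hmem : ∀ (w h : ℂ), ‖w‖ ≤ 1 → ‖h‖ ≤ r' → a + w * h ∈ Metric.ball a r := fun w h hw hh => by
    simp only [Metric.mem_ball, dist_eq_norm, add_sub_cancel_left, norm_mul]
    calc ‖w‖ * ‖h‖ ≤ 1 * ‖h‖ := mul_le_mul_of_nonneg_right hw (norm_nonneg _)
      _ < r := by linarith
  -- rotating the disc leaves the integral unchanged; then average over all rotations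
  have hrot : ∀ θ : ℝ, ∫ h in Metric.ball (0 : ℂ) r', g (a + circleMap 0 1 θ * h) * (k ‖h‖ : ℂ) =
      ∫ h in Metric.ball (0 : ℂ) r', g (a + h) * (k ‖h‖ : ℂ) := fun θ => by
    have := (rotation (Circle.exp θ)).measurePreserving.setIntegral_preimage_emb
      (rotation (Circle.exp θ)).toHomeomorph.measurableEmbedding
      (fun h => g (a + h) * (k ‖h‖ : ℂ)) (Metric.ball (0 : ℂ) r')
    rw [← this]
    have hpre : (rotation (Circle.exp θ)) ⁻¹' Metric.ball (0 : ℂ) r' = Metric.ball (0 : ℂ) r' := by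
      ext h; simp only [Set.mem_preimage, Metric.mem_ball, dist_zero_right,
        LinearIsometryEquiv.norm_map]
    rw [hpre]
    refine integral_congr_ae (Eventually.of_forall fun h => ?_)
    simp [circleMap, Circle.coe_exp, rotation_apply]
  have hmean : ∀ h ∈ Metric.ball (0 : ℂ) r',
      ∫ θ in (0 : ℝ)..2 * Real.pi, g (a + circleMap 0 1 θ * h) * (k ‖h‖ : ℂ) =
        (2 * Real.pi : ℂ) * (g a * (k ‖h‖ : ℂ)) := fun h hh => by
    have hh' : ‖h‖ < r' := by simpa using hh
    have hd : DiffContOnCl ℂ (fun w => g (a + w * h)) (Metric.ball 0 |1|) := by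
      refine DifferentiableOn.diffContOnCl fun w hw => ?_
      have hw1 : ‖w‖ ≤ 1 := by
        have := Metric.closure_ball_subset_closedBall hw
        simpa using this
      have : DifferentiableAt ℂ g (a + w * h) :=
        hg.differentiableAt (Metric.isOpen_ball.mem_nhds (hmem w h hw1 hh'.le))
      exact (this.comp w (by fun_prop)).differentiableWithinAt
    have := hd.circleAverage
    rw [Real.circleAverage_def] at this
    rw [intervalIntegral.integral_mul_const]
    have hπ : (2 * Real.pi : ℝ) ≠ 0 := by positivity
    rw [inv_smul_eq_iff₀ hπ] at this
    rw [this]; simp; ring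
  have hint : Integrable (Function.uncurry fun (θ : ℝ) (h : ℂ) =>
      g (a + circleMap 0 1 θ * h) * (k ‖h‖ : ℂ))
      ((volume.restrict (Set.Ioc 0 (2 * Real.pi))).prod
        (volume.restrict (Metric.ball (0 : ℂ) r'))) := by
    rw [Measure.prod_restrict]
    have hc : ContinuousOn (Function.uncurry fun (θ : ℝ) (h : ℂ) =>
        g (a + circleMap 0 1 θ * h) * (k ‖h‖ : ℂ))
        (Set.Icc 0 (2 * Real.pi) ×ˢ Metric.closedBall (0 : ℂ) r') := by
      refine ContinuousOn.mul (hg.continuousOn.comp (Continuous.continuousOn ?_) ?_)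
        (Continuous.continuousOn ?_)
      · exact continuous_const.add
          (((continuous_circleMap 0 1).comp continuous_fst).mul continuous_snd)
      · rintro ⟨θ, h⟩ ⟨-, hh⟩
        exact hmem _ _ (by simp) (by simpa using hh)
      · exact Complex.continuous_ofReal.comp (hk.comp continuous_snd.norm)
    exact (hc.integrableOn_compact (isCompact_Icc.prod (isCompact_closedBall _ _))).mono_set
      (Set.prod_mono Set.Ioc_subset_Icc_self Metric.ball_subset_closedBall)
  have hsw := integral_integral_swap hint
  simp only [hrot] at hsw
  have h2π : (0 : ℝ) ≤ 2 * Real.pi := by positivity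
  have e : ∫ h in Metric.ball (0 : ℂ) r', ∫ θ in Set.Ioc 0 (2 * Real.pi),
      g (a + circleMap 0 1 θ * h) * (k ‖h‖ : ℂ) =
      ∫ h in Metric.ball (0 : ℂ) r', (2 * Real.pi : ℂ) * (g a * (k ‖h‖ : ℂ)) := by
    refine setIntegral_congr_fun measurableSet_ball fun h hh => ?_
    rw [← hmean h hh, intervalIntegral.integral_of_le h2π]
  rw [e, integral_const_mul, integral_const_mul] at hsw
  have hπ : (2 * Real.pi : ℂ) ≠ 0 := by exact_mod_cast (by positivity : (2 * Real.pi : ℝ) ≠ 0)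
  simp only [integral_const, measureReal_restrict_apply_univ, Real.volume_real_Ioc_of_le h2π,
    sub_zero] at hsw
  rw [Complex.real_smul] at hsw
  push_cast at hsw
  have hfin := mul_left_cancel₀ hπ hsw
  rw [hshift]
  simp only [add_sub_cancel_left]
  rw [hfin, ← integral_complex_ofReal, hshift]
  simp

/-! ### Asymptotics of the extension index -/

lemma l2ExtensionIndex_le {ψ : ℂ → ℝ} {a : ℂ} {r T : ℝ} (hr : 0 < r) {f : ℂ → ℂ}
    (hf : DifferentiableOn ℂ f (Metric.ball a r)) (hfa : f a = 1)
    (hT : weightedNormSq (Metric.ball a r) ψ f ≤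
      ENNReal.ofReal (Real.pi * r ^ 2 * Real.exp (-ψ a) * T)) :
    l2ExtensionIndex ψ a r ≤ ENNReal.ofReal T := by
  have hpos : 0 < Real.pi * r ^ 2 * Real.exp (-ψ a) := by positivity
  rw [l2ExtensionIndex_eq_iInf ψ a hr]
  refine (iInf₂_le f ⟨⟨hf, hT.trans_lt ENNReal.ofReal_lt_top⟩, hfa⟩).trans ?_
  refine ENNReal.div_le_of_le_mul' ?_
  rwa [← ENNReal.ofReal_mul hpos.le]

lemma le_l2ExtensionIndex {ψ : ℂ → ℝ} {a : ℂ} {r T : ℝ} (hr : 0 < r)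
    (hT : ∀ f : ℂ → ℂ, DifferentiableOn ℂ f (Metric.ball a r) → f a = 1 →
      ENNReal.ofReal (Real.pi * r ^ 2 * Real.exp (-ψ a) * T) ≤
        weightedNormSq (Metric.ball a r) ψ f) :
    ENNReal.ofReal T ≤ l2ExtensionIndex ψ a r := by
  have hpos : 0 < Real.pi * r ^ 2 * Real.exp (-ψ a) := by positivity
  rw [l2ExtensionIndex_eq_iInf ψ a hr]
  refine le_iInf₂ fun f hf => ?_
  rw [ENNReal.le_div_iff_mul_le (Or.inl (by simpa using hpos)) (Or.inl ENNReal.ofReal_ne_top),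
    mul_comm, ← ENNReal.ofReal_mul hpos.le]
  exact hT f hf.1.1 hf.2

/-- Subharmonicity near the closed disc gives `L_Φ(a, r) ≤ 1`. -/
lemma l2ExtensionIndex_le_one {Φ : ℂ → ℝ} {a : ℂ} {r R : ℝ} (hr : 0 < r) (hrR : r < R)
    (hΦ : ∀ z ∈ Metric.closedBall a R, ContDiffAt ℝ 2 Φ z)
    (hsub : ∀ z ∈ Metric.closedBall a R, 0 ≤ ddbarCoeff Φ z) :
    l2ExtensionIndex Φ a r ≤ 1 := by
  have hT : ∀ s, r < s → s ≤ R → l2ExtensionIndex Φ a r ≤ ENNReal.ofReal (s ^ 2 / r ^ 2) := by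
    intro s hs hsR
    have hsub' := Metric.closedBall_subset_closedBall (x := a) hsR
    obtain ⟨f, hf, hfa, hn⟩ := exists_sharp_extension hr hs (fun z hz => hΦ z (hsub' hz))
      (fun z hz => hsub z (hsub' hz))
    refine l2ExtensionIndex_le hr hf hfa (hn.trans_eq ?_)
    congr 1
    field_simp
  have hlim : Tendsto (fun s : ℝ => ENNReal.ofReal (s ^ 2 / r ^ 2)) (𝓝[>] r)
      (𝓝 (ENNReal.ofReal (r ^ 2 / r ^ 2))) :=
    (ENNReal.continuous_ofReal.tendsto _).comp
      ((by fun_prop : Continuous fun s : ℝ => s ^ 2 / r ^ 2).tendsto r |>.mono_left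
        nhdsWithin_le_nhds)
  have h1 : r ^ 2 / r ^ 2 = 1 := by field_simp
  rw [h1, ENNReal.ofReal_one] at hlim
  refine ge_of_tendsto hlim ?_
  filter_upwards [Ioc_mem_nhdsGT hrR] with s hs using hT s hs.1 hs.2

lemma exp_neg_le_quadratic {x : ℝ} (hx : 0 ≤ x) : Real.exp (-x) ≤ 1 - x + x ^ 2 / 2 := by
  have h := Real.quadratic_le_exp_of_nonneg hx
  have h2 : 0 < 1 - x + x ^ 2 / 2 := by nlinarith [sq_nonneg (x - 1)]
  rw [Real.exp_neg, inv_le_comm₀ (Real.exp_pos x) h2]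
  refine le_trans ?_ h
  rw [inv_le_iff_one_le_mul₀ h2]
  nlinarith [sq_nonneg (x ^ 2)]

lemma integrableOn_ball_of_continuous {E : Type*} [NormedAddCommGroup E] {g : ℂ → E}
    (hg : Continuous g) (a : ℂ) (r : ℝ) : IntegrableOn g (Metric.ball a r) :=
  (hg.continuousOn.integrableOn_compact (isCompact_closedBall a r)).mono_set
    Metric.ball_subset_closedBall

/-- Where the coefficient of `i∂∂̄Φ` exceeds `2m ≥ 0`, the exponential of the holomorphic part of
the Taylor polynomial shows `L_Φ(a, r) ≤ e^{-m r²}` for small `r`. -/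
lemma exists_l2ExtensionIndex_le {Φ : ℂ → ℝ} {a : ℂ} (hΦ : ContDiffAt ℝ 2 Φ a) {m : ℝ}
    (hm : 0 ≤ m) (hc : 2 * m < ddbarCoeff Φ a) :
    ∃ r₀ : ℝ, 0 < r₀ ∧ ∀ r : ℝ, 0 < r → r < r₀ →
      l2ExtensionIndex Φ a r ≤ ENNReal.ofReal (Real.exp (-m * r ^ 2)) := by
  obtain ⟨p, q, hpq⟩ := exists_taylor_two hΦ
  set c := ddbarCoeff Φ a
  obtain ⟨ρ, hρ, hT⟩ := hpq ((c - 2 * m) / 2) (by linarith)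
  set b := (c + 2 * m) / 2 with hb
  have hb0 : 0 < b := by rw [hb]; linarith
  have hbm : 0 < b / 2 - m := by rw [hb]; linarith
  -- the second bound on `r` makes the quadratic error in `e^{-b s} ≤ 1 - b s + (b s)² / 2` harmless
  refine ⟨min ρ (Real.sqrt (6 * (b / 2 - m) / b ^ 2)), lt_min hρ (Real.sqrt_pos.2 (by positivity)),
    fun r hr hr0 => ?_⟩
  have hrρ : r < ρ := hr0.trans_le (min_le_left _ _)
  have hr2 : b ^ 2 * r ^ 2 ≤ 6 * (b / 2 - m) := by
    have h1 : r ≤ Real.sqrt (6 * (b / 2 - m) / b ^ 2) := (hr0.trans_le (min_le_right _ _)).le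
    have h2 : r ^ 2 ≤ 6 * (b / 2 - m) / b ^ 2 := by
      rw [← Real.sq_sqrt (show 0 ≤ 6 * (b / 2 - m) / b ^ 2 by positivity)]
      gcongr
    rw [le_div_iff₀ (by positivity)] at h2
    linarith
  refine l2ExtensionIndex_le (f := fun z => Complex.exp ((p * (z - a) + q * (z - a) ^ 2) / 2)) hr
    (by fun_prop) (by simp) ?_
  set g : ℂ → ℝ := fun z => Real.exp (-Φ a) *
    (1 - b * ‖z - a‖ ^ (2 * 1) + b ^ 2 / 2 * ‖z - a‖ ^ (2 * 2)) with hg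
  have hpt : ∀ z ∈ Metric.ball a r,
      ‖Complex.exp ((p * (z - a) + q * (z - a) ^ 2) / 2)‖ ^ 2 * Real.exp (-Φ z) ≤ g z := by
    intro z hz
    have hzr : ‖z - a‖ < ρ := lt_trans (by simpa [dist_eq_norm] using hz) hrρ
    have h1 := neg_le_of_abs_le (hT (z - a) hzr)
    rw [add_sub_cancel] at h1
    rw [Complex.norm_exp, ← Real.exp_nat_mul, ← Real.exp_add, hg]
    have h2 := exp_neg_le_quadratic (x := b * ‖z - a‖ ^ 2) (by positivity)
    calc _ ≤ Real.exp (-Φ a + -(b * ‖z - a‖ ^ 2)) := by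
          refine Real.exp_le_exp.2 ?_
          have : ((p * (z - a) + q * (z - a) ^ 2) / 2).re =
              (p * (z - a) + q * (z - a) ^ 2).re / 2 := by
            simp
          rw [this, hb]
          push_cast
          linarith
      _ ≤ _ := by
          rw [Real.exp_add]
          refine mul_le_mul_of_nonneg_left (h2.trans_eq ?_) (Real.exp_pos _).le
          ring
  have hg0 : ∀ z, 0 ≤ g z := fun z => by
    refine mul_nonneg (Real.exp_pos _).le ?_
    have : 0 ≤ 1 - b * ‖z - a‖ ^ 2 + (b * ‖z - a‖ ^ 2) ^ 2 / 2 :=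
      (Real.exp_pos _).le.trans (exp_neg_le_quadratic (by positivity))
    calc 0 ≤ _ := this
      _ = _ := by ring
  have hgc : Continuous g := by fun_prop
  have i1 : IntegrableOn (fun z : ℂ => b * ‖z - a‖ ^ (2 * 1)) (Metric.ball a r) :=
    integrableOn_ball_of_continuous (by fun_prop) a r
  have i2 : IntegrableOn (fun z : ℂ => b ^ 2 / 2 * ‖z - a‖ ^ (2 * 2)) (Metric.ball a r) :=
    integrableOn_ball_of_continuous (by fun_prop) a r
  have i0 : IntegrableOn (fun _ : ℂ => (1 : ℝ)) (Metric.ball a r) :=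
    integrableOn_ball_of_continuous (by fun_prop) a r
  have i01 : IntegrableOn (fun z : ℂ => 1 - b * ‖z - a‖ ^ (2 * 1)) (Metric.ball a r) := i0.sub i1
  have hint : ∫ z in Metric.ball a r, g z = Real.exp (-Φ a) * (Real.pi * r ^ 2 -
      b * (Real.pi * r ^ 4 / 2) + b ^ 2 / 2 * (Real.pi * r ^ 6 / 3)) := by
    rw [hg, integral_const_mul, integral_add i01 i2, integral_sub i0 i1,
      integral_const_mul, integral_const_mul, integral_ball_norm_pow a hr,
      integral_ball_norm_pow a hr, integral_const, measureReal_restrict_apply_univ,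
      volume_real_ball_complex hr.le]
    norm_num
  calc weightedNormSq (Metric.ball a r) Φ _ ≤ ∫⁻ z in Metric.ball a r, ENNReal.ofReal (g z) :=
        setLIntegral_mono' measurableSet_ball fun z hz => ENNReal.ofReal_le_ofReal (hpt z hz)
    _ = ENNReal.ofReal (∫ z in Metric.ball a r, g z) :=
        (ofReal_integral_eq_lintegral_ofReal (integrableOn_ball_of_continuous hgc a r)
          (Eventually.of_forall hg0)).symm
    _ ≤ _ := by
        refine ENNReal.ofReal_le_ofReal ?_
        rw [hint]
        have h3 : 1 - b * r ^ 2 / 2 + b ^ 2 * r ^ 4 / 6 ≤ Real.exp (-m * r ^ 2) := by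
          have := Real.add_one_le_exp (-m * r ^ 2)
          have h4 := mul_le_mul_of_nonneg_right hr2 (sq_nonneg r)
          nlinarith
        have h5 := mul_le_mul_of_nonneg_left h3
          (show 0 ≤ Real.pi * r ^ 2 * Real.exp (-Φ a) by positivity)
        refine le_trans (le_of_eq ?_) h5
        ring

lemma ofReal_integral_le_lintegral_ofReal {α : Type*} [MeasurableSpace α] {μ : Measure α}
    {f : α → ℝ} (hf : Integrable f μ) :
    ENNReal.ofReal (∫ x, f x ∂μ) ≤ ∫⁻ x, ENNReal.ofReal (f x) ∂μ := by
  calc ENNReal.ofReal (∫ x, f x ∂μ) ≤ ENNReal.ofReal (∫ x, max (f x) 0 ∂μ) :=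
        ENNReal.ofReal_le_ofReal (integral_mono hf hf.pos_part fun x => le_max_left _ _)
    _ = ∫⁻ x, ENNReal.ofReal (max (f x) 0) ∂μ :=
        ofReal_integral_eq_lintegral_ofReal hf.pos_part
          (Eventually.of_forall fun x => le_max_right _ _)
    _ = ∫⁻ x, ENNReal.ofReal (f x) ∂μ := by simp

/-- For small `r`, every extension has norm at least that forced by the mean value property:
`L_Φ(a, r) ≥ 1 - b r² / 2` for each `b` larger than the coefficient of `i∂∂̄Φ` at `a`. -/
lemma exists_le_l2ExtensionIndex {Φ : ℂ → ℝ} {a : ℂ} (hΦ : ContDiffAt ℝ 2 Φ a) {b : ℝ}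
    (hb : ddbarCoeff Φ a < b) :
    ∃ r₀ : ℝ, 0 < r₀ ∧ ∀ r : ℝ, 0 < r → r < r₀ →
      ENNReal.ofReal (1 - b * r ^ 2 / 2) ≤ l2ExtensionIndex Φ a r := by
  obtain ⟨p, q, hpq⟩ := exists_taylor_two hΦ
  set c := ddbarCoeff Φ a
  obtain ⟨ρ, hρ, hT⟩ := hpq (b - c) (by linarith)
  refine ⟨ρ, hρ, fun r hr hrρ => le_l2ExtensionIndex hr fun f hf hfa => ?_⟩
  have hsm : ∀ s, 0 < s → s < r → ENNReal.ofReal (Real.pi * s ^ 2 * Real.exp (-Φ a) *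
      (1 - b * s ^ 2 / 2)) ≤ weightedNormSq (Metric.ball a r) Φ f := by
    intro s hs hsr
    set P : ℂ → ℂ := fun z => (p * (z - a) + q * (z - a) ^ 2) / 2 with hP
    set G : ℂ → ℂ := fun z => f z * Complex.exp (-P z) with hG
    have hGd : DifferentiableOn ℂ G (Metric.ball a r) :=
      hf.mul (by fun_prop : Differentiable ℂ fun z => Complex.exp (-P z)).differentiableOn
    have hGa : G a = 1 := by simp [hG, hP, hfa]
    set k : ℝ → ℝ := fun t => Real.exp (-(b * t ^ 2)) with hk
    have hkc : Continuous k := by fun_prop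
    have hsub : Metric.closedBall a s ⊆ Metric.ball a r := Metric.closedBall_subset_ball hsr
    set h : ℂ → ℝ := fun z => Real.exp (-Φ a) * ((2 * (G z).re - 1) * k ‖z - a‖) with hh
    have hpt : ∀ z ∈ Metric.ball a s, h z ≤ ‖f z‖ ^ 2 * Real.exp (-Φ z) := by
      intro z hz
      have hzr : ‖z - a‖ < ρ := lt_trans (lt_trans (by simpa [dist_eq_norm] using hz) hsr) hrρ
      have h1 := le_of_abs_le (hT (z - a) hzr)
      rw [add_sub_cancel] at h1
      -- `|w|² ≥ 2 Re w - 1` replaces the sub-mean value property of `|G|²`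
      have h2 : 2 * (G z).re - 1 ≤ ‖G z‖ ^ 2 := by
        rw [← Complex.normSq_eq_norm_sq, Complex.normSq_apply]
        nlinarith [sq_nonneg ((G z).re - 1), sq_nonneg (G z).im]
      have hre : (P z).re = (p * (z - a) + q * (z - a) ^ 2).re / 2 := by
        simp [hP]
      have h3 : ‖G z‖ ^ 2 = ‖f z‖ ^ 2 * Real.exp (-(p * (z - a) + q * (z - a) ^ 2).re) := by
        rw [hG]
        simp only [norm_mul, mul_pow, Complex.norm_exp, ← Real.exp_nat_mul, Complex.neg_re, hre]
        congr 2
        push_cast; ring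
      calc h z ≤ Real.exp (-Φ a) * (‖G z‖ ^ 2 * k ‖z - a‖) :=
            mul_le_mul_of_nonneg_left (mul_le_mul_of_nonneg_right h2 (Real.exp_pos _).le)
              (Real.exp_pos _).le
        _ = ‖f z‖ ^ 2 * Real.exp (-Φ a + -(p * (z - a) + q * (z - a) ^ 2).re +
              -(b * ‖z - a‖ ^ 2)) := by
            rw [h3, Real.exp_add, Real.exp_add]; ring
        _ ≤ _ := by
            refine mul_le_mul_of_nonneg_left (Real.exp_le_exp.2 ?_) (by positivity)
            linarith
    have hGc : ContinuousOn G (Metric.closedBall a s) := hGd.continuousOn.mono hsub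
    have hkn : Continuous fun z : ℂ => k ‖z - a‖ := by fun_prop
    have i1 : IntegrableOn (fun z => (G z).re * k ‖z - a‖) (Metric.ball a s) :=
      (((Complex.continuous_re.comp_continuousOn hGc).mul hkn.continuousOn).integrableOn_compact
        (isCompact_closedBall a s)).mono_set Metric.ball_subset_closedBall
    have i2 : IntegrableOn (fun z => k ‖z - a‖) (Metric.ball a s) :=
      integrableOn_ball_of_continuous hkn a s
    have iG : IntegrableOn (fun z => G z * (k ‖z - a‖ : ℂ)) (Metric.ball a s) :=
      ((hGc.mul (Complex.continuous_ofReal.comp hkn).continuousOn).integrableOn_compact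
        (isCompact_closedBall a s)).mono_set Metric.ball_subset_closedBall
    have hih : IntegrableOn h (Metric.ball a s) := by
      refine Integrable.const_mul (((i1.const_mul 2).sub i2).congr (Eventually.of_forall
        fun z => ?_)) _
      simp only [Pi.sub_apply]; ring
    have hre : ∫ z in Metric.ball a s, (G z).re * k ‖z - a‖ =
        ∫ z in Metric.ball a s, k ‖z - a‖ := by
      have h1 := congrArg Complex.re (integral_ball_mul_radial hsr hGd hkc)
      rw [hGa, one_mul, Complex.ofReal_re] at h1
      rw [← h1]
      have := integral_re (𝕜 := ℂ) iG
      simpa using this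
    have hint : ∫ z in Metric.ball a s, h z =
        Real.exp (-Φ a) * ∫ z in Metric.ball a s, k ‖z - a‖ := by
      rw [hh, integral_const_mul]
      congr 1
      have : ∀ z, (2 * (G z).re - 1) * k ‖z - a‖ = 2 * ((G z).re * k ‖z - a‖) - k ‖z - a‖ :=
        fun z => by ring
      simp only [this]
      rw [integral_sub (i1.const_mul 2) i2, integral_const_mul, hre]; ring
    have hlow : Real.pi * s ^ 2 - b * (Real.pi * s ^ 4 / 2) ≤
        ∫ z in Metric.ball a s, k ‖z - a‖ := by
      have i0 : IntegrableOn (fun _ : ℂ => (1 : ℝ)) (Metric.ball a s) :=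
        integrableOn_ball_of_continuous (by fun_prop) a s
      have i3 : IntegrableOn (fun z : ℂ => b * ‖z - a‖ ^ (2 * 1)) (Metric.ball a s) :=
        integrableOn_ball_of_continuous (by fun_prop) a s
      have : ∫ z in Metric.ball a s, (1 - b * ‖z - a‖ ^ (2 * 1)) =
          Real.pi * s ^ 2 - b * (Real.pi * s ^ 4 / 2) := by
        rw [integral_sub i0 i3, integral_const_mul, integral_ball_norm_pow a hs, integral_const,
          measureReal_restrict_apply_univ, volume_real_ball_complex hs.le]
        norm_num
      rw [← this]
      refine integral_mono (i0.sub i3) i2 fun z => ?_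
      have := Real.add_one_le_exp (-(b * ‖z - a‖ ^ 2))
      simp only [hk, mul_one]
      linarith
    calc ENNReal.ofReal (Real.pi * s ^ 2 * Real.exp (-Φ a) * (1 - b * s ^ 2 / 2))
        ≤ ENNReal.ofReal (∫ z in Metric.ball a s, h z) := by
          refine ENNReal.ofReal_le_ofReal ?_
          rw [hint]
          refine le_trans (le_of_eq ?_) (mul_le_mul_of_nonneg_left hlow (Real.exp_pos _).le)
          ring
      _ ≤ ∫⁻ z in Metric.ball a s, ENNReal.ofReal (h z) :=
          ofReal_integral_le_lintegral_ofReal hih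
      _ ≤ ∫⁻ z in Metric.ball a s, ENNReal.ofReal (‖f z‖ ^ 2 * Real.exp (-Φ z)) :=
          setLIntegral_mono' measurableSet_ball fun z hz => ENNReal.ofReal_le_ofReal (hpt z hz)
      _ ≤ weightedNormSq (Metric.ball a r) Φ f :=
          lintegral_mono_set (Metric.ball_subset_ball hsr.le)
  have hlim : Tendsto (fun s : ℝ => ENNReal.ofReal (Real.pi * s ^ 2 * Real.exp (-Φ a) *
      (1 - b * s ^ 2 / 2))) (𝓝[<] r) (𝓝 (ENNReal.ofReal (Real.pi * r ^ 2 * Real.exp (-Φ a) *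
      (1 - b * r ^ 2 / 2)))) :=
    (ENNReal.continuous_ofReal.tendsto _).comp
      ((by fun_prop : Continuous fun s : ℝ => Real.pi * s ^ 2 * Real.exp (-Φ a) *
        (1 - b * s ^ 2 / 2)).tendsto r |>.mono_left nhdsWithin_le_nhds)
  refine le_of_tendsto hlim ?_
  filter_upwards [Ioo_mem_nhdsLT hr] with s hs using hsm s hs.1 hs.2

/-! ### Smoothness of fibre integrals -/

lemma exists_eventually_forall_norm_le {X Y E : Type*} [TopologicalSpace X]
    [LocallyCompactSpace X] [TopologicalSpace Y] [SeminormedAddCommGroup E] {f : X × Y → E}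
    {U : Set X} {K : Set Y} (hU : IsOpen U) (hK : IsCompact K) (hf : ContinuousOn f (U ×ˢ K))
    {x : X} (hx : x ∈ U) :
    ∃ C : ℝ, ∀ᶠ x' in 𝓝 x, x' ∈ U ∧ ∀ z ∈ K, ‖f (x', z)‖ ≤ C := by
  obtain ⟨V, hV, hVU, hVc⟩ := local_compact_nhds (hU.mem_nhds hx)
  obtain ⟨C, hC⟩ := (hVc.prod hK).exists_bound_of_continuousOn
    (hf.mono (Set.prod_mono hVU subset_rfl))
  exact ⟨C, by filter_upwards [hV] with x' hx' using ⟨hVU hx', fun z hz => hC _ ⟨hx', hz⟩⟩⟩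

section FibreIntegral

universe u

variable {X E : Type u} {Y : Type*} [NormedAddCommGroup X] [NormedSpace ℝ X]
  [NormedAddCommGroup Y] [NormedSpace ℝ Y] [NormedAddCommGroup E] [NormedSpace ℝ E]

/-- On `U × K` with `U` open and `K` arbitrary, derivatives within the set are unique only in the
first variable; the partial derivative in that variable still loses just one order of
smoothness. -/
lemma contDiffOn_fderiv_prodMk_left {f : X × Y → E} {U : Set X} {K : Set Y} (hU : IsOpen U)
    {m : ℕ} (hf : ContDiffOn ℝ (m + 1 : ℕ) f (U ×ˢ K)) :
    ContDiffOn ℝ m (fun p : X × Y => fderiv ℝ (fun x => f (x, p.2)) p.1) (U ×ˢ K) ∧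
      ∀ p ∈ U ×ˢ K, DifferentiableAt ℝ (fun x => f (x, p.2)) p.1 := by
  have key : ∀ p ∈ U ×ˢ K, ∃ f' : X × Y → X × Y →L[ℝ] E, ContDiffWithinAt ℝ m f' (U ×ˢ K) p ∧
      ∀ᶠ q in 𝓝[U ×ˢ K] p, HasFDerivAt (fun x => f (x, q.2))
        ((f' q).comp (ContinuousLinearMap.inl ℝ X Y)) q.1 := by
    intro p hp
    have h := hf p hp
    rw [Nat.cast_add, Nat.cast_one, contDiffWithinAt_succ_iff_hasFDerivWithinAt (by simp),
      Set.insert_eq_of_mem hp] at h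
    obtain ⟨u, hu, -, f', hf', hc⟩ := h
    refine ⟨f', hc.mono_of_mem_nhdsWithin hu, ?_⟩
    have h1 : ∀ᶠ q in 𝓝[U ×ˢ K] p, u ∈ 𝓝[U ×ˢ K] q := eventually_eventually_nhdsWithin.2 hu
    filter_upwards [h1, hu, self_mem_nhdsWithin] with q hq hqu hqS
    have hι : HasFDerivAt (fun x : X => (x, q.2)) (ContinuousLinearMap.inl ℝ X Y) q.1 :=
      hasFDerivAt_prodMk_left q.1 q.2
    have ht : Tendsto (fun x : X => (x, q.2)) (𝓝 q.1) (𝓝[U ×ˢ K] q) := by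
      refine tendsto_nhdsWithin_iff.2 ⟨hι.continuousAt, ?_⟩
      filter_upwards [hU.mem_nhds hqS.1] with x hx using ⟨hx, hqS.2⟩
    have hs : (fun x : X => (x, q.2)) ⁻¹' u ∈ 𝓝 q.1 := ht hq
    exact (HasFDerivWithinAt.comp q.1 (t := u) (hf' q hqu) hι.hasFDerivWithinAt
      (Set.mapsTo_preimage _ _)).hasFDerivAt hs
  refine ⟨fun p hp => ?_, fun p hp => ?_⟩
  · obtain ⟨f', hc, hd⟩ := key p hp
    refine ContDiffWithinAt.congr_of_eventuallyEq_of_mem (f := fun q =>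
      (f' q).comp (ContinuousLinearMap.inl ℝ X Y)) ?_ ?_ hp
    · exact hc.clm_comp contDiffWithinAt_const
    · filter_upwards [hd] with q hq using hq.fderiv
  · obtain ⟨f', hc, hd⟩ := key p hp
    exact (hd.self_of_nhdsWithin hp).differentiableAt

variable [LocallyCompactSpace X] [MeasurableSpace Y] [BorelSpace Y] [SecondCountableTopology Y]

/-- Differentiation under the integral sign, to any finite order, for an integrand that is smooth
up to the boundary of a bounded fibre. -/
lemma contDiffOn_setIntegral_prodMk {μ : Measure Y} [IsFiniteMeasureOnCompacts μ]
    {U : Set X} {Ω K : Set Y} (hU : IsOpen U) (hΩ : MeasurableSet Ω) (hK : IsCompact K)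
    (hΩK : Ω ⊆ K) (m : ℕ) :
    ∀ {E : Type u} [NormedAddCommGroup E] [NormedSpace ℝ E] {f : X × Y → E},
      ContDiffOn ℝ m f (U ×ˢ K) → ContDiffOn ℝ m (fun x => ∫ z in Ω, f (x, z) ∂μ) U := by
  have hμ : μ Ω < ∞ := (measure_mono hΩK).trans_lt hK.measure_lt_top
  have hslice : ∀ {E : Type u} [NormedAddCommGroup E] {f : X × Y → E},
      ContinuousOn f (U ×ˢ K) → ∀ x ∈ U, ContinuousOn (fun z => f (x, z)) Ω := fun hf x hx =>
    hf.comp (by fun_prop) fun z hz => ⟨hx, hΩK hz⟩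
  induction m with
  | zero =>
    intro E _ _ f hf
    rw [Nat.cast_zero, contDiffOn_zero] at hf ⊢
    intro x hx
    obtain ⟨C, hC⟩ := exists_eventually_forall_norm_le hU hK hf hx
    refine (continuousAt_of_dominated (bound := fun _ => C) ?_ ?_ ?_ ?_).continuousWithinAt
    · filter_upwards [hC] with x' hx' using (hslice hf x' hx'.1).aestronglyMeasurable hΩ
    · filter_upwards [hC] with x' hx'
      filter_upwards [ae_restrict_mem hΩ] with z hz using hx'.2 z (hΩK hz)
    · exact integrableOn_const hμ.ne
    · filter_upwards [ae_restrict_mem hΩ] with z hz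
      exact ContinuousOn.continuousAt (s := U)
        (hf.comp (by fun_prop) fun x' hx' => ⟨hx', hΩK hz⟩) (hU.mem_nhds hx)
  | succ m ih =>
    intro E _ _ f hf
    obtain ⟨hg, hd⟩ := contDiffOn_fderiv_prodMk_left hU hf
    have hG := ih hg
    have hder : ∀ x ∈ U, HasFDerivAt (fun x => ∫ z in Ω, f (x, z) ∂μ)
        (∫ z in Ω, fderiv ℝ (fun x' => f (x', z)) x ∂μ) x := by
      intro x hx
      obtain ⟨C, hC⟩ := exists_eventually_forall_norm_le hU hK hg.continuousOn hx
      obtain ⟨C', hC'⟩ := exists_eventually_forall_norm_le hU hK hf.continuousOn hx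
      refine hasFDerivAt_integral_of_dominated_of_fderiv_le (bound := fun _ => C)
        (F' := fun x z => fderiv ℝ (fun x' => f (x', z)) x) hC ?_ ?_ ?_ ?_ ?_ ?_
      · filter_upwards [hC] with x' hx'
        exact (hslice hf.continuousOn x' hx'.1).aestronglyMeasurable hΩ
      · have : IsFiniteMeasure (μ.restrict Ω) := ⟨by simpa using hμ⟩
        refine Integrable.of_bound
          ((hslice hf.continuousOn x hx).aestronglyMeasurable hΩ) C' ?_
        filter_upwards [ae_restrict_mem hΩ] with z hz
        exact hC'.self_of_nhds.2 z (hΩK hz)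
      · exact (hslice hg.continuousOn x hx).aestronglyMeasurable hΩ
      · filter_upwards [ae_restrict_mem hΩ] with z hz x' hx' using hx'.2 z (hΩK hz)
      · exact integrableOn_const hμ.ne
      · filter_upwards [ae_restrict_mem hΩ] with z hz x' hx'
        exact (hd (x', z) ⟨hx'.1, hΩK hz⟩).hasFDerivAt
    rw [Nat.cast_add, Nat.cast_one, contDiffOn_succ_iff_fderiv_of_isOpen hU]
    exact ⟨fun x hx => (hder x hx).differentiableAt.differentiableWithinAt, by simp,
      hG.congr fun x hx => (hder x hx).fderiv⟩

end FibreIntegral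

lemma contDiffAt_fiberPotential {n : ℕ} {U : Set ℂ} {Ω : Set (Fin n → ℂ)}
    {φ : ℂ × (Fin n → ℂ) → ℝ} (hU : IsOpen U) (hΩo : IsOpen Ω) (hΩn : Ω.Nonempty)
    (hΩb : Bornology.IsBounded Ω) (hφ : ContDiffOn ℝ 2 φ (closure (U ×ˢ Ω))) {τ : ℂ}
    (hτ : τ ∈ U) : ContDiffAt ℝ 2 (fiberPotential Ω φ) τ := by
  have hsub : U ×ˢ closure Ω ⊆ closure (U ×ˢ Ω) := by
    rw [closure_prod_eq]
    exact Set.prod_mono subset_closure subset_rfl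
  have h := contDiffOn_setIntegral_prodMk (μ := volume) hU hΩo.measurableSet
    hΩb.isCompact_closure subset_closure 2 (f := fun p => Real.exp (-φ p))
    ((hφ.mono hsub).neg.exp)
  refine ((h.contDiffAt (hU.mem_nhds hτ)).log ?_).neg
  rw [← (exp_neg_fiberPotential hΩo hΩn hΩb hφ.continuousOn hτ).2]
  exact (Real.exp_pos _).ne'

/-! ### The curvature criterion -/

/-- For a bounded open set the supremum defining `innerRadius` is over a nonempty bounded set, so
it is positive, and smaller radii give closed discs inside the set. -/
lemma innerRadius_pos_and_closedBall_subset {U : Set ℂ} (hU : IsOpen U)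
    (hUb : Bornology.IsBounded U) {a : ℂ}
    (ha : a ∈ U) : 0 < innerRadius U a ∧
      ∀ r < innerRadius U a, Metric.closedBall a r ⊆ U := by
  obtain ⟨s, hs, hsU⟩ := Metric.isOpen_iff.1 hU a ha
  have hne : {r : ℝ | 0 < r ∧ Metric.ball a r ⊆ U}.Nonempty := ⟨s, hs, hsU⟩
  have hbdd : BddAbove {r : ℝ | 0 < r ∧ Metric.ball a r ⊆ U} := by
    obtain ⟨C, hC⟩ := hUb.subset_closedBall a
    refine ⟨C, fun r hr => le_of_forall_lt fun t ht => ?_⟩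
    by_contra! hCt
    have hC0 : 0 ≤ C := by
      simpa using dist_nonneg.trans (Metric.mem_closedBall.1 (hC ha))
    -- the point of the ball at distance strictly between `t` and `r` from the centre
    have hmem : a + (((t + r) / 2 : ℝ) : ℂ) ∈ Metric.ball a r := by
      rw [mem_ball_iff_norm, add_sub_cancel_left, Complex.norm_real, Real.norm_eq_abs,
        abs_of_nonneg (by linarith)]
      linarith
    have := hC (hr.2 hmem)
    rw [mem_closedBall_iff_norm, add_sub_cancel_left, Complex.norm_real, Real.norm_eq_abs,
      abs_of_nonneg (by linarith)] at this
    linarith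
  refine ⟨hs.trans_le (le_csSup hbdd ⟨hs, hsU⟩), fun r hr => ?_⟩
  obtain ⟨t, ht, hrt⟩ := exists_lt_of_lt_csSup hne hr
  exact (Metric.closedBall_subset_ball hrt).trans ht.2

/-- The two bounds `1 - b r² / 2 ≤ L ≤ e^{-m r²}` can hold for all small `r` only if
`m ≤ b / 2`. -/
lemma le_half_of_forall_small {b m r₀ : ℝ} (hm : 0 ≤ m) (hr₀ : 0 < r₀)
    (h : ∀ r : ℝ, 0 < r → r < r₀ → 1 - b * r ^ 2 / 2 ≤ Real.exp (-m * r ^ 2)) : m ≤ b / 2 := by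
  have hlim : Tendsto (fun r : ℝ => b / 2 + m ^ 2 * r ^ 2 / 2) (𝓝[>] 0) (𝓝 (b / 2)) := by
    have : Continuous fun r : ℝ => b / 2 + m ^ 2 * r ^ 2 / 2 := by fun_prop
    simpa using (this.tendsto 0).mono_left nhdsWithin_le_nhds
  refine ge_of_tendsto hlim ?_
  filter_upwards [Ioo_mem_nhdsGT hr₀] with r hr
  have h1 := h r hr.1 hr.2
  have h2 := exp_neg_le_quadratic (x := m * r ^ 2) (by positivity)
  rw [← neg_mul] at h2
  have hr2 : 0 < r ^ 2 := by have := hr.1; positivity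
  refine le_of_mul_le_mul_right ?_ hr2
  nlinarith

/-- The criterion for any `C²` weight; smoothness of the weight is all that the fibre integral
contributes. -/
lemma curvatureGE_iff_l2ExtensionIndex_le {U : Set ℂ} {Φ g : ℂ → ℝ} (hUo : IsOpen U)
    (hUb : Bornology.IsBounded U) (hΦ : ∀ a ∈ U, ContDiffAt ℝ 2 Φ a) (hg : ∀ a ∈ U, 0 ≤ g a) :
    CurvatureGE U Φ g ↔
      ∀ a ∈ U, ∀ ε : ℝ, 0 < ε →
        ∃ rε : ℝ, 0 < rε ∧ rε < innerRadius U a ∧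
          ∀ r : ℝ, 0 < r → r < rε →
            l2ExtensionIndex Φ a r
              ≤ ENNReal.ofReal (Real.exp (-(max ((g a - ε) / 2) 0) * r ^ 2)) := by
  constructor
  · intro hc a ha ε hε
    obtain ⟨hδ, hball⟩ := innerRadius_pos_and_closedBall_subset hUo hUb ha
    set δ := innerRadius U a
    rcases le_or_gt (g a - ε) 0 with h0 | h0
    · refine ⟨δ / 2, by linarith, by linarith, fun r hr hrδ => ?_⟩
      rw [max_eq_right (by linarith)]
      simp only [neg_zero, zero_mul, Real.exp_zero, ENNReal.ofReal_one]
      have hsub := hball (δ / 2) (by linarith)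
      exact l2ExtensionIndex_le_one hr hrδ (fun z hz => hΦ z (hsub hz))
        fun z hz => (hg z (hsub hz)).trans (hc z (hsub hz))
    · obtain ⟨r₀, hr₀, h⟩ := exists_l2ExtensionIndex_le (hΦ a ha)
        (m := (g a - ε) / 2) (by linarith) (by have := hc a ha; linarith)
      refine ⟨min r₀ (δ / 2), lt_min hr₀ (by linarith), (min_le_right _ _).trans_lt (by linarith),
        fun r hr hrr => ?_⟩
      rw [max_eq_left (by linarith)]
      exact h r hr (hrr.trans_le (min_le_left _ _))
  · intro h a ha
    refine le_of_forall_pos_le_add fun η hη => ?_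
    obtain ⟨r₁, hr₁, h₁⟩ := exists_le_l2ExtensionIndex (hΦ a ha)
      (b := ddbarCoeff Φ a + η / 2) (by linarith)
    obtain ⟨r₂, hr₂, -, h₂⟩ := h a ha (η / 2) (by linarith)
    have key := le_half_of_forall_small (b := ddbarCoeff Φ a + η / 2)
      (le_max_right ((g a - η / 2) / 2) 0) (lt_min hr₁ hr₂) fun r hr hrr =>
      (ENNReal.ofReal_le_ofReal_iff (Real.exp_pos _).le).1
        ((h₁ r hr (hrr.trans_le (min_le_left _ _))).trans
          (h₂ r hr (hrr.trans_le (min_le_right _ _))))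
    have := le_max_left ((g a - η / 2) / 2) 0
    linarith

theorem mainTheorem9 {n : ℕ} (U : Set ℂ) (Ω : Set (Fin n → ℂ))
    (hUo : IsOpen U) (hUc : IsConnected U) (hUb : Bornology.IsBounded U)
    (hΩo : IsOpen Ω) (hΩc : IsConnected Ω) (hΩb : Bornology.IsBounded Ω)
    (φ : ℂ × (Fin n → ℂ) → ℝ)
    (hφ : ContDiffOn ℝ ((⊤ : ℕ∞) : WithTop ℕ∞) φ (closure (U ×ˢ Ω)))
    (g : ℂ → ℝ) (hg : ∀ a ∈ U, 0 ≤ g a) :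
    CurvatureGE U (fiberPotential Ω φ) g ↔
      ∀ a ∈ U, ∀ ε : ℝ, 0 < ε →
        ∃ rε : ℝ, 0 < rε ∧ rε < innerRadius U a ∧
          ∀ r : ℝ, 0 < r → r < rε →
            l2ExtensionIndex (fiberPotential Ω φ) a r
              ≤ ENNReal.ofReal (Real.exp (-(max ((g a - ε) / 2) 0) * r ^ 2)) :=
  curvatureGE_iff_l2ExtensionIndex_le hUo hUb (fun _ ha => contDiffAt_fiberPotential hUo hΩo
    hΩc.nonempty hΩb (hφ.of_le ENat.LEInfty.out) ha) hg
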